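/- **Setting.** Let $1\le m\le n$, let $A\in\mathbb R^{n\times n}$ have all its eigenvalues in the open unit disc, let $B\in\mathbb R^{n\times m}$ have rank $m$, let $(A,B)$ be reachable, and put $G(z)=(zI-A)^{-1}B$. Integrals $\int$ are over the unit circle $\mathbb T$ with respect to normalized Lebesgue measure, and $*$ is the conjugate transpose on $\mathbb T$. Let $\mathcal S_+^{m\times m}$ be the set of (measurable) bounded and coercive spectral densities on $\mathbb T$ of $\mathbb R^m$-valued processes: Hermitian-valued functions $\Phi$ with $\Phi(\bar z)=\Phi(z)^T$ and $\alpha I<\Phi\le\beta I$ a.e. for some $0<\alpha\le\beta$; densities equal a.e. are identified. Let $\Psi\in\mathcal S_+^{m\times m}$ be rational (without poles on $\mathbb T$), let $W$ be a square spectral factor of $\Psi$, that is $WW^*=\Psi$ on $\mathbb T$ (for instance the stable minimum phase one), and put $G_1=GW$. Let $\Gamma(\Phi)=\int G\Phi G^*$ on the real linear space generated by the continuous spectral densities of $\mathbb R^m$-valued processes, and let $$\mathcal L_+^\Gamma=\{\Lambda=\Lambda^T\in\operatorname{Range}\Gamma\;:\; I+G_1^*\Lambda G_1>0\ \text{ on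 }\mathbb T\}.$$ Let $\Sigma=\Sigma^T>0$ be a real $n\times n$ matrix. The dual functional on $\mathcal L_+^\Gamma$ is $$J_\Psi(\Lambda)=\int\left[\operatorname{tr}(\Lambda\Sigma)-\log\det(I+G_1^*\Lambda G_1)\right],$$ which for $\Sigma=I$ is $\int\left[\operatorname{tr}\Lambda-\operatorname{tr}\log(I+G_1^*\Lambda G_1)\right]$. On the closure of $\mathcal L_+^\Gamma$ it is extended, with values in $(-\infty,+\infty]$, by $$J_\Psi^\infty(\Lambda)=\lim_{k\to\infty}\int\left[\operatorname{tr}(\Lambda\Sigma)-\log\det\left(I+G_1^*\Lambda G_1+\tfrac1k I\right)\right].$$ The spectrum approximation problem is to minimize $$d_{RER}(\Phi,\Psi)=\tfrac12\int\left\{\log\det(\Phi^{-1}\Psi)+\operatorname{tr}\left[\Psi^{-1}(\Phi-\Psi)\right]\right\}$$ over all $\Phi\in\mathcal S_+^{m\times m}$ with $\int G\Phi G^*=\Sigma$. **Theorem.** Assume that there is $H\in\mathbb R^{m\times n}$ with $\Sigma-A\Sigma A^T=BH+H^TB^T$. Then: 1. $\mathcal L_+^\Gamma$ is an open subset of $\operatorname{Range}\Gamma$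 and is unbounded. 2. $J_\Psi$ has a unique minimizer $\Lambda^\circ$ over $\mathcal L_+^\Gamma$. It lies in the interior of $\mathcal L_+^\Gamma$ (relative to $\operatorname{Range}\Gamma$) and not on the boundary; moreover $J_\Psi(\Lambda^\circ)<J^\infty_\Psi(\Lambda)$ for every $\Lambda\ne\Lambda^\circ$ in the closure of $\mathcal L_+^\Gamma$. 3. $\Phi^\circ=[\Psi^{-1}+G^*\Lambda^\circ G]^{-1}$ satisfies $\int G\Phi^\circ G^*=\Sigma$ and is the unique solution of the spectrum approximation problem. -/

import Mathlib

open MeasureTheory Matrix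

open scoped ComplexOrder

namespace RER

noncomputable section

/-- The unit circle carries its Borel σ-algebra. -/
instance : MeasurableSpace Circle := borel Circle

instance : BorelSpace Circle := ⟨rfl⟩

/-- Normalized Lebesgue (arc length) measure on the unit circle `𝕋`. -/
def circleMeasure : Measure Circle :=
  Measure.map Circle.exp
    (ENNReal.ofReal (1 / (2 * Real.pi)) • volume.restrict (Set.Ioc (-Real.pi) Real.pi))

/-- The complex matrix with the same entries as the real matrix `M`. -/
def toC {p q : ℕ} (M : Matrix (Fin p) (Fin q) ℝ) : Matrix (Fin p) (Fin q) ℂ :=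
  M.map (fun x : ℝ => (x : ℂ))

/-- `A` is a stability matrix: all its (complex) eigenvalues lie in the open unit disc. -/
def IsStable {n : ℕ} (A : Matrix (Fin n) (Fin n) ℝ) : Prop :=
  ∀ μ ∈ spectrum ℂ (toC A), ‖μ‖ < 1

/-- `(A, B)` is reachable: the columns of `B, AB, …, Aⁿ⁻¹B` span `ℝⁿ`. -/
def IsReachable {n m : ℕ} (A : Matrix (Fin n) (Fin n) ℝ) (B : Matrix (Fin n) (Fin m) ℝ) : Prop :=
  ⨆ k : Fin n, LinearMap.range (A ^ (k : ℕ) * B).mulVecLin = ⊤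

/-- The transfer function `G(z) = (zI - A)⁻¹ B`, on the unit circle. -/
def G {n m : ℕ} (A : Matrix (Fin n) (Fin n) ℝ) (B : Matrix (Fin n) (Fin m) ℝ) (z : Circle) :
    Matrix (Fin n) (Fin m) ℂ :=
  ((z : ℂ) • (1 : Matrix (Fin n) (Fin n) ℂ) - toC A)⁻¹ * toC B

/-- The entrywise integral `∫ G Φ G^*` over the unit circle, for normalized Lebesgue measure. -/
def moment {n m : ℕ} (A : Matrix (Fin n) (Fin n) ℝ) (B : Matrix (Fin n) (Fin m) ℝ)
    (Φ : Circle → Matrix (Fin m) (Fin m) ℂ) : Matrix (Fin n) (Fin n) ℂ :=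
  Matrix.of fun i j => ∫ z, (G A B z * Φ z * (G A B z)ᴴ) i j ∂circleMeasure

/-- Bounded and coercive spectral densities of `ℝᵐ`-valued processes. The identity
`Φ(z⁻¹) = Φ(z)ᵀ` (with `z⁻¹ = conj z` on the circle) says that the process is real. -/
structure IsBddCoerciveDensity {m : ℕ} (Φ : Circle → Matrix (Fin m) (Fin m) ℂ) : Prop where
  aemeasurable : ∀ i j, AEMeasurable (fun z => Φ z i j) circleMeasure
  real : ∀ᵐ z ∂circleMeasure, Φ z⁻¹ = (Φ z)ᵀ
  bounded : ∃ β : ℝ, ∀ᵐ z ∂circleMeasure,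
    ((β : ℂ) • (1 : Matrix (Fin m) (Fin m) ℂ) - Φ z).PosSemidef
  coercive : ∃ α : ℝ, 0 < α ∧ ∀ᵐ z ∂circleMeasure,
    (Φ z - (α : ℂ) • (1 : Matrix (Fin m) (Fin m) ℂ)).PosDef

/-- Continuous spectral densities of `ℝᵐ`-valued processes. -/
structure IsContDensity {m : ℕ} (Φ : Circle → Matrix (Fin m) (Fin m) ℂ) : Prop where
  continuous : Continuous Φ
  real : ∀ z, Φ z⁻¹ = (Φ z)ᵀ
  posSemidef : ∀ z, (Φ z).PosSemidef

/-- The real linear space generated by the continuous spectral densities. -/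
def contDensitySpan (m : ℕ) : Submodule ℝ (Circle → Matrix (Fin m) (Fin m) ℂ) :=
  Submodule.span ℝ {Φ | IsContDensity Φ}

/-- The range of the operator `Γ : Φ ↦ ∫ G Φ G^*` on the space generated by the continuous
spectral densities, as a set of real matrices. -/
def rangeGamma {n m : ℕ} (A : Matrix (Fin n) (Fin n) ℝ) (B : Matrix (Fin n) (Fin m) ℝ) :
    Set (Matrix (Fin n) (Fin n) ℝ) :=
  {M | ∃ Φ ∈ contDensitySpan m, toC M = moment A B Φ}

/-- `Ψ` is rational: on the circle its entries are quotients of polynomials, without poles there. -/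
def IsRational {m : ℕ} (Ψ : Circle → Matrix (Fin m) (Fin m) ℂ) : Prop :=
  ∃ (P : Matrix (Fin m) (Fin m) (Polynomial ℂ)) (q : Polynomial ℂ), ∀ z : Circle,
    q.eval (z : ℂ) ≠ 0 ∧ ∀ i j, Ψ z i j = (P i j).eval (z : ℂ) / q.eval (z : ℂ)

/-- `W` is a square spectral factor of `Ψ`. -/
def IsSpectralFactor {m : ℕ} (W Ψ : Circle → Matrix (Fin m) (Fin m) ℂ) : Prop :=
  ∀ z, W z * (W z)ᴴ = Ψ z

/-- `Q_Λ = I + G₁^* Λ G₁` with `G₁ = G W`. -/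
def Q {n m : ℕ} (A : Matrix (Fin n) (Fin n) ℝ) (B : Matrix (Fin n) (Fin m) ℝ)
    (W : Circle → Matrix (Fin m) (Fin m) ℂ) (Λ : Matrix (Fin n) (Fin n) ℝ) (z : Circle) :
    Matrix (Fin m) (Fin m) ℂ :=
  1 + (G A B z * W z)ᴴ * toC Λ * (G A B z * W z)

/-- The set `𝓛₊` of symmetric `Λ` with `I + G₁^* Λ G₁ > 0` on the unit circle. -/
def Lplus {n m : ℕ} (A : Matrix (Fin n) (Fin n) ℝ) (B : Matrix (Fin n) (Fin m) ℝ)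
    (W : Circle → Matrix (Fin m) (Fin m) ℂ) : Set (Matrix (Fin n) (Fin n) ℝ) :=
  {Λ | Λ.IsSymm ∧ ∀ z, (Q A B W Λ z).PosDef}

/-- `𝓛₊^Γ = 𝓛₊ ∩ Range Γ`, as a subset of the space `Range Γ`. -/
def LplusGamma {n m : ℕ} (A : Matrix (Fin n) (Fin n) ℝ) (B : Matrix (Fin n) (Fin m) ℝ)
    (W : Circle → Matrix (Fin m) (Fin m) ℂ) : Set (rangeGamma A B) :=
  {Λ | (Λ : Matrix (Fin n) (Fin n) ℝ) ∈ Lplus A B W}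

/-- The dual functional `∫ (tr (Λ S) - log det (I + G₁^* Λ G₁))`, where `S` is the prescribed
state covariance. -/
def J {n m : ℕ} (A : Matrix (Fin n) (Fin n) ℝ) (B : Matrix (Fin n) (Fin m) ℝ)
    (S : Matrix (Fin n) (Fin n) ℝ) (W : Circle → Matrix (Fin m) (Fin m) ℂ)
    (Λ : Matrix (Fin n) (Fin n) ℝ) : ℝ :=
  ∫ z, ((Λ * S).trace - Real.log (Q A B W Λ z).det.re) ∂circleMeasure

/-- The regularized functional `∫ (tr (Λ S) - log det (I + G₁^* Λ G₁ + ε I))`. -/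
def Jreg {n m : ℕ} (A : Matrix (Fin n) (Fin n) ℝ) (B : Matrix (Fin n) (Fin m) ℝ)
    (S : Matrix (Fin n) (Fin n) ℝ) (W : Circle → Matrix (Fin m) (Fin m) ℂ) (ε : ℝ)
    (Λ : Matrix (Fin n) (Fin n) ℝ) : ℝ :=
  ∫ z, ((Λ * S).trace -
    Real.log (Q A B W Λ z + (ε : ℂ) • (1 : Matrix (Fin m) (Fin m) ℂ)).det.re) ∂circleMeasure

/-- The extended-real-valued extension of the dual functional to the closure of `𝓛₊^Γ`: the limit
(supremum) of the increasing sequence of functionals regularized with `ε = 1/(k+1)`. -/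
def Jinf {n m : ℕ} (A : Matrix (Fin n) (Fin n) ℝ) (B : Matrix (Fin n) (Fin m) ℝ)
    (S : Matrix (Fin n) (Fin n) ℝ) (W : Circle → Matrix (Fin m) (Fin m) ℂ)
    (Λ : Matrix (Fin n) (Fin n) ℝ) : EReal :=
  ⨆ k : ℕ, ((Jreg A B S W (1 / ((k : ℝ) + 1)) Λ : ℝ) : EReal)

/-- The relative entropy rate pseudo-distance between spectral densities. -/
def dRER {m : ℕ} (Φ Ψ : Circle → Matrix (Fin m) (Fin m) ℂ) : ℝ :=
  (1 / 2) * ∫ z, (Real.log ((Φ z)⁻¹ * Ψ z).det.re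
    + ((Ψ z)⁻¹ * (Φ z - Ψ z)).trace.re) ∂circleMeasure

/-- The feasible set: bounded coercive spectral densities with `∫ G Φ G^* = S`. -/
def feasible {n m : ℕ} (A : Matrix (Fin n) (Fin n) ℝ) (B : Matrix (Fin n) (Fin m) ℝ)
    (S : Matrix (Fin n) (Fin n) ℝ) : Set (Circle → Matrix (Fin m) (Fin m) ℂ) :=
  {Φ | IsBddCoerciveDensity Φ ∧ moment A B Φ = toC S}

/-- `Φ` solves the spectrum approximation problem: it minimizes `dRER · Ψ` over the feasible set. -/
def IsSolution {n m : ℕ} (A : Matrix (Fin n) (Fin n) ℝ) (B : Matrix (Fin n) (Fin m) ℝ)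
    (S : Matrix (Fin n) (Fin n) ℝ) (Ψ Φ : Circle → Matrix (Fin m) (Fin m) ℂ) : Prop :=
  Φ ∈ feasible A B S ∧ ∀ Φ' ∈ feasible A B S, dRER Φ Ψ ≤ dRER Φ' Ψ

/-- `Φ°(Λ) = (Ψ⁻¹ + G^* Λ G)⁻¹`. -/
def PhiOpt {n m : ℕ} (A : Matrix (Fin n) (Fin n) ℝ) (B : Matrix (Fin n) (Fin m) ℝ)
    (Ψ : Circle → Matrix (Fin m) (Fin m) ℂ) (Λ : Matrix (Fin n) (Fin n) ℝ) (z : Circle) :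
    Matrix (Fin m) (Fin m) ℂ :=
  ((Ψ z)⁻¹ + (G A B z)ᴴ * toC Λ * G A B z)⁻¹

end

end RER

namespace RER

noncomputable section

/-! ### Positive definite matrices: concavity of log det and trace inequalities. -/

section MatrixLemmas

variable {m : ℕ}

/-! Put `F_Λ = Ψ⁻¹ + G^* Λ G` (`dualF`), which is affine in `Λ`. Since `W^* Ψ⁻¹ W = I`, one has `I +
G₁^* Λ G₁ = W^* F_Λ W` (`Q_eq_congruence`), so up to a constant the dual functional is `tr(ΛS) - ∫
log det F_Λ`. Almost everything rests on one tangent inequality, `log det Y ≤ log det X + tr X⁻¹(Y -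
X)`, with equality only for `Y = X` (`logDet_le_add_trace`, `integral_logDet_le`). Applied to `F_Λ`
it makes the dual functional convex, strictly so on `Range Γ` because `M ↦ G^* M G` is injective
there (`eq_zero_of_hG_eq_zero`). Applied to densities it shows that any `Φ° = F_Λ⁻¹` with the right
moment is the unique primal optimum (`dRER_phiOpt_le`): the multiplier term takes the same value on
all feasible densities.

It remains to find `Λ` in the open domain with `∫ G Φ° G^* = S`. The covariance equation yields a
continuous positive density `Φ` with moment `S` (`exists_density`), by a state feedback that turns
it into a Lyapunov equation. Then `tr(ΛS)` is `∫ tr(F_Λ Φ)` up to a constant, and linear growth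
beats the logarithm, so minimizing sequences are bounded. A limit point `Λ` may a priori lie on the
boundary, so it is characterized only by derivatives at interior points (Minty's inequality,
`exists_minty`).

The boundary is excluded as follows (`dualDom_of_minty`). Minty's inequality at `(1-t)Λ` bounds `∫
tr(F_{(1-t)Λ}⁻¹ Ψ⁻¹)` uniformly in `t`. If `F_Λ` had a kernel vector `v` at a point of the circle,
then `v^* F_Λ v`, being differentiable in the angle, would grow at most linearly there, and the
integral would diverge like `log(1/t)`. Hence `Λ` is interior, Minty's inequality becomes
stationarity on `Range Γ`, and testing the direction `∫ G Φ° G^* - S` gives the moment constraint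
(`exists_dual_solution`). -/

theorem posDef_exists_factor {X : Matrix (Fin m) (Fin m) ℂ} (hX : X.PosDef) :
    ∃ C : Matrix (Fin m) (Fin m) ℂ, IsUnit C.det ∧ X = Cᴴ * C := by
  obtain ⟨C, hC, h⟩ : ∃ C : Matrix (Fin m) (Fin m) ℂ, IsUnit C ∧ X = star C * C := by
    open scoped MatrixOrder in
    exact CStarAlgebra.isStrictlyPositive_iff_eq_star_mul_self.mp
      (Matrix.isStrictlyPositive_iff_posDef.mpr hX)
  exact ⟨C, (Matrix.isUnit_iff_isUnit_det C).mp hC, h⟩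

theorem posSemidef_exists_factor {X : Matrix (Fin m) (Fin m) ℂ} (hX : X.PosSemidef) :
    ∃ C : Matrix (Fin m) (Fin m) ℂ, X = Cᴴ * C := by
  open scoped MatrixOrder in
  exact CStarAlgebra.nonneg_iff_eq_star_mul_self.mp (Matrix.nonneg_iff_posSemidef.mpr hX)

theorem trace_mul_nonneg {X Y : Matrix (Fin m) (Fin m) ℂ} (hX : X.PosSemidef)
    (hY : Y.PosSemidef) : 0 ≤ (X * Y).trace.re := by
  obtain ⟨C, rfl⟩ := posSemidef_exists_factor hX
  rw [Matrix.mul_assoc, Matrix.trace_mul_comm]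
  exact (Complex.nonneg_iff.mp (hY.mul_mul_conjTranspose_same C).trace_nonneg).1

theorem trace_mul_mono_right {X Y Z : Matrix (Fin m) (Fin m) ℂ} (hX : X.PosSemidef)
    (hYZ : (Z - Y).PosSemidef) : (X * Y).trace.re ≤ (X * Z).trace.re := by
  have := trace_mul_nonneg hX hYZ
  rw [Matrix.mul_sub, Matrix.trace_sub, Complex.sub_re] at this
  linarith

/-- The real logarithm of the determinant of a positive definite matrix. -/
def logDet (X : Matrix (Fin m) (Fin m) ℂ) : ℝ := Real.log X.det.re

theorem posDef_det_re_pos {X : Matrix (Fin m) (Fin m) ℂ} (hX : X.PosDef) : 0 < X.det.re :=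
  (Complex.pos_iff.mp hX.det_pos).1

theorem isUnit_det_of_posDef {X : Matrix (Fin m) (Fin m) ℂ} (hX : X.PosDef) : IsUnit X.det :=
  hX.det_pos.ne'.isUnit

theorem eq_one_of_eigenvalues_eq_one {X : Matrix (Fin m) (Fin m) ℂ} (hX : X.IsHermitian)
    (h : ∀ i, hX.eigenvalues i = 1) : X = 1 := by
  have h1 := hX.spectral_theorem
  rw [show (RCLike.ofReal ∘ hX.eigenvalues : Fin m → ℂ) = fun _ => 1 from
    funext fun i => by simp [h i]] at h1
  rw [h1, Matrix.diagonal_one, map_one]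

theorem logDet_eq_sum {X : Matrix (Fin m) (Fin m) ℂ} (hX : X.PosDef) :
    logDet X = ∑ i, Real.log (hX.1.eigenvalues i) := by
  have h : X.det = ((∏ i, hX.1.eigenvalues i : ℝ) : ℂ) := by
    rw [hX.1.det_eq_prod_eigenvalues]; push_cast; rfl
  rw [logDet, h, Complex.ofReal_re, Real.log_prod fun i _ => (hX.eigenvalues_pos i).ne']

theorem trace_re_eq_sum {X : Matrix (Fin m) (Fin m) ℂ} (hX : X.IsHermitian) :
    X.trace.re = ∑ i, hX.eigenvalues i := by
  rw [hX.trace_eq_sum_eigenvalues]; simp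

/-- This is `log x ≤ x - 1` summed over the eigenvalues; its equality case forces every eigenvalue
to be 1. -/
theorem logDet_le_trace_sub {X : Matrix (Fin m) (Fin m) ℂ} (hX : X.PosDef) :
    logDet X ≤ X.trace.re - m := by
  have h : ∑ i, Real.log (hX.1.eigenvalues i) ≤ ∑ i, (hX.1.eigenvalues i - 1) :=
    Finset.sum_le_sum fun i _ => Real.log_le_sub_one_of_pos (hX.eigenvalues_pos i)
  rw [logDet_eq_sum hX, trace_re_eq_sum hX.1]
  simpa using h

theorem eq_one_of_logDet_eq {X : Matrix (Fin m) (Fin m) ℂ} (hX : X.PosDef)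
    (h : logDet X = X.trace.re - m) : X = 1 := by
  refine eq_one_of_eigenvalues_eq_one hX.1 fun i => ?_
  have h2 : ∑ i, Real.log (hX.1.eigenvalues i) = ∑ i, (hX.1.eigenvalues i - 1) := by
    rw [logDet_eq_sum hX, trace_re_eq_sum hX.1] at h
    simpa using h
  have h3 := (Finset.sum_eq_sum_iff_of_le fun i _ =>
    Real.log_le_sub_one_of_pos (hX.eigenvalues_pos i)).mp h2 i (Finset.mem_univ i)
  by_contra hne
  exact (Real.log_lt_sub_one_of_pos (hX.eigenvalues_pos i) hne).ne h3

theorem logDet_mul {X Y : Matrix (Fin m) (Fin m) ℂ} (hX : X.PosDef) (hY : Y.PosDef) :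
    Real.log (X * Y).det.re = logDet X + logDet Y := by
  rw [logDet, logDet, ← Real.log_mul (posDef_det_re_pos hX).ne' (posDef_det_re_pos hY).ne',
    Matrix.det_mul, Complex.mul_re, ← (Complex.pos_iff.mp hX.det_pos).2]
  simp

theorem logDet_inv {X : Matrix (Fin m) (Fin m) ℂ} (hX : X.PosDef) :
    logDet X⁻¹ = - logDet X := by
  have h := logDet_mul hX hX.inv
  rw [Matrix.mul_nonsing_inv _ (isUnit_det_of_posDef hX)] at h
  simp only [det_one, Complex.one_re, Real.log_one] at h
  linarith

/-- Congruence reducing a pair of positive definite matrices to one. -/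
theorem exists_congruence {X Y : Matrix (Fin m) (Fin m) ℂ} (hX : X.PosDef) (hY : Y.PosDef) :
    ∃ Z : Matrix (Fin m) (Fin m) ℂ, Z.PosDef ∧ logDet Y = logDet X + logDet Z ∧
      (X⁻¹ * (Y - X)).trace.re = Z.trace.re - m ∧ (Z = 1 → Y = X) := by
  -- With `X = C^* C`, the matrix `Z = C^{-*} Y C⁻¹` compares `Y` with `X` as if `X` were the
  -- identity, which reduces the tangent inequality to the case `X = 1`.
  obtain ⟨C, hC, rfl⟩ := posDef_exists_factor hX
  have hCu : IsUnit C := (Matrix.isUnit_iff_isUnit_det C).mpr hC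
  have hCi : C * C⁻¹ = 1 := Matrix.mul_nonsing_inv _ hC
  have hCi' : C⁻¹ * C = 1 := Matrix.nonsing_inv_mul _ hC
  have hCh : Cᴴ * (C⁻¹)ᴴ = 1 := by rw [← conjTranspose_mul, hCi', conjTranspose_one]
  have hCh' : (C⁻¹)ᴴ * Cᴴ = 1 := by rw [← conjTranspose_mul, hCi, conjTranspose_one]
  have hYZ : Y = Cᴴ * ((C⁻¹)ᴴ * Y * C⁻¹) * C := by
    simp only [Matrix.mul_assoc, hCi', Matrix.mul_one]
    rw [← Matrix.mul_assoc, hCh, Matrix.one_mul]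
  have hZ : ((C⁻¹)ᴴ * Y * C⁻¹).PosDef := by
    refine hY.conjTranspose_mul_mul_same (Matrix.mulVec_injective_of_isUnit ?_)
    exact (Matrix.isUnit_nonsing_inv_iff).mpr hCu
  refine ⟨(C⁻¹)ᴴ * Y * C⁻¹, hZ, ?_, ?_, fun h => ?_⟩
  · rw [← logDet_mul hX hZ, logDet]
    congr 2
    conv_lhs => rw [hYZ]
    simp only [det_mul]; ring
  · have h1 : (Cᴴ * C)⁻¹ = C⁻¹ * (C⁻¹)ᴴ := by
      rw [Matrix.mul_inv_rev, Matrix.conjTranspose_nonsing_inv]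
    rw [Matrix.mul_sub, Matrix.nonsing_inv_mul _ (isUnit_det_of_posDef hX), h1, trace_sub,
      Matrix.mul_assoc, Matrix.trace_mul_comm]
    simp
  · rw [hYZ, h, Matrix.mul_one]

theorem logDet_le_add_trace {X Y : Matrix (Fin m) (Fin m) ℂ} (hX : X.PosDef) (hY : Y.PosDef) :
    logDet Y ≤ logDet X + (X⁻¹ * (Y - X)).trace.re := by
  obtain ⟨Z, hZ, h1, h2, -⟩ := exists_congruence hX hY
  rw [h1, h2]
  linarith [logDet_le_trace_sub hZ]

theorem eq_of_logDet_eq_add_trace {X Y : Matrix (Fin m) (Fin m) ℂ} (hX : X.PosDef)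
    (hY : Y.PosDef) (h : logDet Y = logDet X + (X⁻¹ * (Y - X)).trace.re) : Y = X := by
  obtain ⟨Z, hZ, h1, h2, h3⟩ := exists_congruence hX hY
  exact h3 (eq_one_of_logDet_eq hZ (by linarith))

theorem logDet_mono {X Y : Matrix (Fin m) (Fin m) ℂ} (hX : X.PosDef) (hY : Y.PosDef)
    (h : (Y - X).PosSemidef) : logDet X ≤ logDet Y := by
  have h1 := logDet_le_add_trace hY hX
  have h2 := trace_mul_nonneg hY.inv.posSemidef h
  rw [← neg_sub, Matrix.mul_neg, trace_neg, Complex.neg_re] at h1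
  linarith

theorem trace_inv_mul_sub {X Y : Matrix (Fin m) (Fin m) ℂ} (hX : X.PosDef) :
    (X⁻¹ * (Y - X)).trace.re = (X⁻¹ * Y).trace.re - m := by
  rw [Matrix.mul_sub, Matrix.nonsing_inv_mul _ (isUnit_det_of_posDef hX)]
  simp

theorem posSemidef_of_forall_re {X : Matrix (Fin m) (Fin m) ℂ} (hX : X.IsHermitian)
    (h : ∀ v, 0 ≤ (star v ⬝ᵥ (X *ᵥ v)).re) : X.PosSemidef :=
  .of_dotProduct_mulVec_nonneg hX fun v =>
    Complex.nonneg_iff.mpr ⟨h v, (hX.im_star_dotProduct_mulVec_self v).symm⟩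

theorem posDef_of_forall_re {X : Matrix (Fin m) (Fin m) ℂ} (hX : X.IsHermitian)
    (h : ∀ v, v ≠ 0 → 0 < (star v ⬝ᵥ (X *ᵥ v)).re) : X.PosDef :=
  .of_dotProduct_mulVec_pos hX fun v hv =>
    Complex.pos_iff.mpr ⟨h v hv, (hX.im_star_dotProduct_mulVec_self v).symm⟩

/-- A lower bound of a weighted trace of an inverse by the reciprocal of a quadratic form. -/
theorem le_trace_inv_mul {X Y : Matrix (Fin m) (Fin m) ℂ} {v : Fin m → ℂ} {κ : ℝ}
    (hX : X.PosDef) (hv : v ≠ 0)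
    (hκY : ((κ : ℂ) • Y - vecMulVec v (star v)).PosSemidef) :
    (star v ⬝ᵥ v).re ^ 2 / (star v ⬝ᵥ (X *ᵥ v)).re ≤ κ * (X⁻¹ * Y).trace.re := by
  have h1 := trace_mul_nonneg hX.inv.posSemidef hκY
  have h2 : (X⁻¹ * ((κ : ℂ) • Y - vecMulVec v (star v))).trace.re
      = κ * (X⁻¹ * Y).trace.re - (star v ⬝ᵥ (X⁻¹ *ᵥ v)).re := by
    rw [Matrix.mul_sub, trace_sub, Complex.sub_re, Matrix.mul_smul, trace_smul,
      Matrix.mul_vecMulVec, trace_vecMulVec, dotProduct_comm]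
    simp
  have hq : 0 < (star v ⬝ᵥ (X *ᵥ v)).re := hX.re_dotProduct_pos hv
  set q := (star v ⬝ᵥ (X *ᵥ v)).re with hqd
  set a := (star v ⬝ᵥ v).re with had
  -- Cauchy–Schwarz in the form `X⁻¹`: expand its value at `s X v - v`, then take the minimizing `s
  -- = a / q` to get `v^* X⁻¹ v ≥ a² / q`.
  have h3 : ∀ s : ℝ, 0 ≤ s ^ 2 * q - 2 * s * a + (star v ⬝ᵥ (X⁻¹ *ᵥ v)).re := by
    intro s
    have h := hX.inv.posSemidef.re_dotProduct_nonneg ((s : ℂ) • (X *ᵥ v) - v)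
    have hXi : X⁻¹ *ᵥ (X *ᵥ v) = v := by
      rw [mulVec_mulVec, Matrix.nonsing_inv_mul _ (isUnit_det_of_posDef hX), one_mulVec]
    have e2 : star (X *ᵥ v) ⬝ᵥ (X⁻¹ *ᵥ v) = star v ⬝ᵥ v := by
      rw [star_mulVec, ← dotProduct_mulVec, mulVec_mulVec, hX.1.eq,
        Matrix.mul_nonsing_inv _ (isUnit_det_of_posDef hX), one_mulVec]
    have e3 : star (X *ᵥ v) ⬝ᵥ v = star v ⬝ᵥ (X *ᵥ v) := by
      rw [star_mulVec, ← dotProduct_mulVec, hX.1.eq]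
    simp only [mulVec_sub, mulVec_smul, hXi, star_sub, star_smul, sub_dotProduct, dotProduct_sub,
      smul_dotProduct, dotProduct_smul, e2, e3] at h
    simp only [RCLike.star_def, Complex.conj_ofReal, smul_eq_mul, RCLike.re_to_complex,
      Complex.sub_re, Complex.re_ofReal_mul] at h
    nlinarith [h]
  have h4 := h3 (a / q)
  have h5 : (a / q) ^ 2 * q - 2 * (a / q) * a = - (a ^ 2 / q) := by field_simp; ring
  linarith

end MatrixLemmas

/-! ### Normalized Lebesgue measure on the circle. -/

section CircleMeasure

open Set

theorem circleMeasure_apply {s : Set Circle} (hs : MeasurableSet s) :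
    circleMeasure s = ENNReal.ofReal (1 / (2 * Real.pi)) *
      volume (Circle.exp ⁻¹' s ∩ Ioc (-Real.pi) Real.pi) := by
  rw [circleMeasure, Measure.map_apply Circle.exp.continuous.measurable hs, Measure.smul_apply,
    Measure.restrict_apply (Circle.exp.continuous.measurable hs), smul_eq_mul]

instance : IsProbabilityMeasure circleMeasure := by
  refine ⟨?_⟩
  rw [circleMeasure_apply MeasurableSet.univ, preimage_univ, univ_inter, Real.volume_Ioc,
    ← ENNReal.ofReal_mul (by positivity), ← ENNReal.ofReal_one]
  congr 1
  have := Real.pi_pos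
  field_simp; ring

instance : circleMeasure.IsOpenPosMeasure := by
  refine ⟨fun U hU ⟨z, hz⟩ h0 => ?_⟩
  have hV : IsOpen (Circle.exp ⁻¹' U) := hU.preimage Circle.exp.continuous
  have hzV : Complex.arg z ∈ Circle.exp ⁻¹' U := by simpa using hz
  -- A left neighbourhood is used because the argument may equal `π`, the included right end of the
  -- parameter interval.
  obtain ⟨a, ha, hau⟩ := exists_Ioc_subset_of_mem_nhds (hV.mem_nhds hzV) ⟨-Real.pi - 1, by
    linarith [Complex.neg_pi_lt_arg z]⟩
  rw [circleMeasure_apply hU.measurableSet, mul_eq_zero] at h0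
  rcases h0 with h0 | h0
  · have : 0 < 1 / (2 * Real.pi) := by positivity
    simp only [ENNReal.ofReal_eq_zero] at h0
    linarith
  · have hsub : Ioc (max a (-Real.pi)) (Complex.arg z) ⊆
        Circle.exp ⁻¹' U ∩ Ioc (-Real.pi) Real.pi := fun x hx =>
      ⟨hau ⟨(le_max_left _ _).trans_lt hx.1, hx.2⟩,
        ⟨(le_max_right _ _).trans_lt hx.1, hx.2.trans (Complex.arg_le_pi _)⟩⟩
    have h1 := measure_mono_null hsub h0
    rw [Real.volume_Ioc, ENNReal.ofReal_eq_zero] at h1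
    have : max a (-Real.pi) < Complex.arg z := max_lt ha (Complex.neg_pi_lt_arg _)
    linarith

theorem integral_circleMeasure {E : Type*} [NormedAddCommGroup E] [NormedSpace ℝ E]
    {f : Circle → E} (hf : Continuous f) :
    ∫ z, f z ∂circleMeasure
      = (1 / (2 * Real.pi)) • ∫ θ in (-Real.pi)..Real.pi, f (Circle.exp θ) := by
  have hpi := Real.pi_pos
  rw [circleMeasure, integral_map Circle.exp.continuous.aemeasurable
    hf.aestronglyMeasurable, integral_smul_measure, intervalIntegral.integral_of_le (by linarith),
    ENNReal.toReal_ofReal (by positivity)]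

theorem measurePreserving_inv :
    MeasurePreserving (fun z : Circle => z⁻¹) circleMeasure circleMeasure := by
  refine ⟨continuous_inv.measurable, Measure.ext fun s hs => ?_⟩
  have hs' : MeasurableSet ((fun z : Circle => z⁻¹) ⁻¹' s) := continuous_inv.measurable hs
  rw [Measure.map_apply continuous_inv.measurable hs, circleMeasure_apply hs,
    circleMeasure_apply hs']
  congr 1
  -- Inversion is `θ ↦ -θ`, which exchanges the two half-open intervals; they differ by null sets.
  have h1 : Circle.exp ⁻¹' ((fun z : Circle => z⁻¹) ⁻¹' s) ∩ Ioc (-Real.pi) Real.pi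
      = Neg.neg ⁻¹' (Circle.exp ⁻¹' s ∩ Ico (-Real.pi) Real.pi) := by
    ext x
    simp only [mem_inter_iff, mem_preimage, Circle.exp_neg, mem_Ioc, mem_Ico]
    constructor
    · rintro ⟨h, h1, h2⟩; exact ⟨h, by linarith, by linarith⟩
    · rintro ⟨h, h1, h2⟩; exact ⟨h, by linarith, by linarith⟩
  rw [h1, (Measure.measurePreserving_neg volume).measure_preimage
    ((Circle.exp.continuous.measurable hs).inter measurableSet_Ico).nullMeasurableSet]
  exact measure_congr ((Filter.EventuallyEq.refl _ _).inter Ico_ae_eq_Ioc)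

theorem integral_inv_circle {E : Type*} [NormedAddCommGroup E] [NormedSpace ℝ E]
    (f : Circle → E) : ∫ z, f z⁻¹ ∂circleMeasure = ∫ z, f z ∂circleMeasure :=
  measurePreserving_inv.integral_comp (Homeomorph.inv Circle).measurableEmbedding f

theorem integrable_of_continuous {E : Type*} [NormedAddCommGroup E] {f : Circle → E}
    (hf : Continuous f) : Integrable f circleMeasure :=
  hf.integrable_of_hasCompactSupport (HasCompactSupport.of_compactSpace f)

/-- A conull set is dense, as nonempty open sets have positive measure. This upgrades the a.e.
properties of the continuous density `Ψ` to every point. -/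
theorem forall_of_ae_of_isClosed {p : Circle → Prop} (hp : IsClosed {z | p z})
    (h : ∀ᵐ z ∂circleMeasure, p z) (z : Circle) : p z := by
  have hd : Dense {z | p z} := Measure.dense_of_ae h
  have := hd.closure_eq
  rw [hp.closure_eq] at this
  have h2 : z ∈ {z | p z} := by rw [this]; exact mem_univ z
  exact h2

theorem eq_zero_of_integral_nonneg {f : Circle → ℝ} (hf : Continuous f) (h0 : ∀ z, 0 ≤ f z)
    (h : ∫ z, f z ∂circleMeasure ≤ 0) (z : Circle) : f z = 0 := by
  have h1 := (integral_eq_zero_iff_of_nonneg h0 (integrable_of_continuous hf)).mp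
    (le_antisymm h (integral_nonneg h0))
  exact congrFun ((hf.ae_eq_iff_eq circleMeasure continuous_zero).mp h1) z

/-- The mean value property. -/
theorem integral_circle_eq_center {f : ℂ → ℂ}
    (hf : ∀ w : ℂ, ‖w‖ ≤ 1 → DifferentiableAt ℂ f w) :
    ∫ z : Circle, f z ∂circleMeasure = f 0 := by
  have hc : Continuous fun z : Circle => f z :=
    continuous_iff_continuousAt.mpr fun z =>
      ContinuousAt.comp (f := fun z : Circle => (z : ℂ)) (hf z z.norm_coe.le).continuousAt
        (by fun_prop)
  have h1 : Real.circleAverage f 0 1 = f 0 :=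
    circleAverage_of_differentiable_on_off_countable countable_empty
      (fun w hw => (hf w (by simpa using hw)).continuousAt.continuousWithinAt)
      (fun w hw => hf w (by simpa using (mem_ball_zero_iff.mp hw.1).le))
  rw [integral_circleMeasure hc, ← h1, Real.circleAverage_def]
  have hp : Function.Periodic (fun θ : ℝ => f (Circle.exp θ)) (2 * Real.pi) := fun θ => by
    simp
  have h2 := hp.intervalIntegral_add_eq (-Real.pi) 0
  rw [show -Real.pi + 2 * Real.pi = Real.pi by ring, zero_add] at h2
  rw [h2]
  simp [circleMap]

end CircleMeasure

/-! ### Complexification of real matrices. -/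

section ToC

variable {p q r : ℕ}

theorem toC_mul (M : Matrix (Fin p) (Fin q) ℝ) (N : Matrix (Fin q) (Fin r) ℝ) :
    toC (M * N) = toC M * toC N :=
  Matrix.map_mul (f := Complex.ofRealHom)

theorem toC_add (M N : Matrix (Fin p) (Fin q) ℝ) : toC (M + N) = toC M + toC N := by
  ext; simp [toC]

theorem toC_sub (M N : Matrix (Fin p) (Fin q) ℝ) : toC (M - N) = toC M - toC N := by
  ext; simp [toC]

theorem toC_smul (c : ℝ) (M : Matrix (Fin p) (Fin q) ℝ) : toC (c • M) = (c : ℂ) • toC M := by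
  ext; simp [toC]

theorem toC_zero : toC (0 : Matrix (Fin p) (Fin q) ℝ) = 0 := by
  ext; simp [toC]

theorem toC_one : toC (1 : Matrix (Fin p) (Fin p) ℝ) = 1 := by
  ext i j; by_cases h : i = j <;> simp [toC, Matrix.one_apply, h]

theorem toC_transpose (M : Matrix (Fin p) (Fin q) ℝ) : toC Mᵀ = (toC M)ᴴ := by
  ext; simp [toC]

theorem toC_conj (M : Matrix (Fin p) (Fin q) ℝ) : (toC M)ᴴᵀ = toC M := by
  ext; simp [toC]

theorem toC_injective : Function.Injective (toC : Matrix (Fin p) (Fin q) ℝ → _) := fun M N h => by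
  ext i j
  have := congrFun (congrFun h i) j
  simpa [toC] using this

theorem toC_trace_re (M : Matrix (Fin p) (Fin p) ℝ) : (toC M).trace.re = M.trace := by
  simp [toC, Matrix.trace]

theorem continuous_toC : Continuous (toC : Matrix (Fin p) (Fin q) ℝ → _) :=
  continuous_id.matrix_map Complex.continuous_ofReal

theorem posDef_toC {M : Matrix (Fin p) (Fin p) ℝ} (hM : M.PosDef) : (toC M).PosDef := by
  have hs : M.IsSymm := by
    rw [IsSymm, ← conjTranspose_eq_transpose_of_trivial]; exact hM.1
  have hH : (toC M).IsHermitian := by rw [IsHermitian, ← toC_transpose, hs.eq]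
  refine posDef_of_forall_re hH fun v hv => ?_
  set a : Fin p → ℝ := fun i => (v i).re with ha
  set b : Fin p → ℝ := fun i => (v i).im with hb
  -- For `v = a + ib` the cross terms are purely imaginary.
  have key : (star v ⬝ᵥ (toC M *ᵥ v)).re = star a ⬝ᵥ (M *ᵥ a) + star b ⬝ᵥ (M *ᵥ b) := by
    simp only [dotProduct, mulVec, Pi.star_apply, Complex.re_sum, toC, map_apply, ha, hb,
      RCLike.star_def, Complex.mul_re, Complex.conj_re, Complex.conj_im, Complex.re_sum,
      Complex.im_sum, Complex.mul_im, Complex.ofReal_re, Complex.ofReal_im, star_trivial,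
      ← Finset.sum_add_distrib]
    exact Finset.sum_congr rfl fun i _ => by simp
  have h0 : a ≠ 0 ∨ b ≠ 0 := by
    by_contra! h
    exact hv (funext fun i => Complex.ext (congrFun h.1 i) (congrFun h.2 i))
  have hn : ∀ c : Fin p → ℝ, 0 ≤ star c ⬝ᵥ (M *ᵥ c) := hM.posSemidef.dotProduct_mulVec_nonneg
  rw [key]
  rcases h0 with h | h
  · exact add_pos_of_pos_of_nonneg (hM.dotProduct_mulVec_pos h) (hn b)
  · exact add_pos_of_nonneg_of_pos (hn a) (hM.dotProduct_mulVec_pos h)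

end ToC

/-! ### Conjugate-symmetric functions, which encode reality of the process. -/

section ConjSymm

variable {p q r : ℕ}

/-- `F (z⁻¹)` is the entrywise conjugate of `F z`. -/
def ConjSymm (F : Circle → Matrix (Fin p) (Fin q) ℂ) : Prop := ∀ z, F z⁻¹ = (F z)ᴴᵀ

theorem ConjSymm.mul {F : Circle → Matrix (Fin p) (Fin q) ℂ}
    {H : Circle → Matrix (Fin q) (Fin r) ℂ} (hF : ConjSymm F) (hH : ConjSymm H) :
    ConjSymm fun z => F z * H z := fun z => by
  beta_reduce; rw [hF z, hH z, conjTranspose_mul, transpose_mul]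

theorem ConjSymm.add {F H : Circle → Matrix (Fin p) (Fin q) ℂ}
    (hF : ConjSymm F) (hH : ConjSymm H) : ConjSymm fun z => F z + H z := fun z => by
  beta_reduce; rw [hF z, hH z, conjTranspose_add, transpose_add]

theorem ConjSymm.sub {F H : Circle → Matrix (Fin p) (Fin q) ℂ}
    (hF : ConjSymm F) (hH : ConjSymm H) : ConjSymm fun z => F z - H z := fun z => by
  beta_reduce; rw [hF z, hH z, conjTranspose_sub, transpose_sub]

theorem ConjSymm.inv {F : Circle → Matrix (Fin p) (Fin p) ℂ} (hF : ConjSymm F) :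
    ConjSymm fun z => (F z)⁻¹ := fun z => by
  beta_reduce; rw [hF z, conjTranspose_nonsing_inv, transpose_nonsing_inv]

theorem ConjSymm.conjTranspose {F : Circle → Matrix (Fin p) (Fin q) ℂ} (hF : ConjSymm F) :
    ConjSymm fun z => (F z)ᴴ := fun z => by
  beta_reduce; rw [hF z]; ext i j; simp

theorem ConjSymm.toC (M : Matrix (Fin p) (Fin q) ℝ) : ConjSymm fun _ => RER.toC M :=
  fun _ => (toC_conj M).symm

theorem ConjSymm.one : ConjSymm fun _ => (1 : Matrix (Fin p) (Fin p) ℂ) := fun _ => by simp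

theorem ConjSymm.coe_smul_one :
    ConjSymm fun z : Circle => ((z : ℂ) • (1 : Matrix (Fin p) (Fin p) ℂ)) := fun z => by
  beta_reduce
  rw [Circle.coe_inv_eq_conj, conjTranspose_smul, transpose_smul]; simp

/-- The integral equals its own conjugate, because `z ↦ z⁻¹` preserves the measure and conjugates
the integrand. -/
theorem ConjSymm.exists_toC_integral {F : Circle → Matrix (Fin p) (Fin q) ℂ} (hF : ConjSymm F) :
    ∃ M : Matrix (Fin p) (Fin q) ℝ,
      RER.toC M = Matrix.of fun i j => ∫ z, F z i j ∂circleMeasure := by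
  refine ⟨Matrix.of fun i j => (∫ z, F z i j ∂circleMeasure).re, ?_⟩
  ext i j
  have h : (starRingEnd ℂ) (∫ z, F z i j ∂circleMeasure) = ∫ z, F z i j ∂circleMeasure := by
    rw [← integral_conj, ← integral_inv_circle]
    refine integral_congr_ae (.of_forall fun z => ?_)
    have := congrFun (congrFun (hF z) i) j
    simp only [transpose_apply, conjTranspose_apply] at this
    simp [this]
  simpa [RER.toC] using Complex.conj_eq_iff_re.mp h

end ConjSymm

/-! ### Essentially bounded matrix functions: one class for continuous and merely measurable
densities. -/

section Bounded

variable {p q r : ℕ}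

/-- Essentially bounded measurable matrix functions on the circle. -/
def EssBdd (F : Circle → Matrix (Fin p) (Fin q) ℂ) : Prop :=
  ∀ i j, MemLp (fun z => F z i j) ⊤ circleMeasure

theorem EssBdd.of_continuous {F : Circle → Matrix (Fin p) (Fin q) ℂ} (hF : Continuous F) :
    EssBdd F := fun i j => by
  have hc : Continuous fun z => F z i j := hF.matrix_elem i j
  obtain ⟨C, hC⟩ := (isCompact_range hc.norm).bddAbove
  exact memLp_top_of_bound hc.aestronglyMeasurable C (.of_forall fun z => hC ⟨z, rfl⟩)

theorem EssBdd.mul {F : Circle → Matrix (Fin p) (Fin q) ℂ}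
    {H : Circle → Matrix (Fin q) (Fin r) ℂ} (hF : EssBdd F) (hH : EssBdd H) :
    EssBdd fun z => F z * H z := fun i j => by
  simp only [Matrix.mul_apply]
  exact memLp_finsetSum _ fun k _ => (hH k j).mul (hF i k)

theorem EssBdd.sub {F H : Circle → Matrix (Fin p) (Fin q) ℂ}
    (hF : EssBdd F) (hH : EssBdd H) : EssBdd fun z => F z - H z := fun i j =>
  (hF i j).sub (hH i j)

theorem EssBdd.integrable {F : Circle → Matrix (Fin p) (Fin q) ℂ} (hF : EssBdd F) (i j) :
    Integrable (fun z => F z i j) circleMeasure := (hF i j).integrable le_top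

theorem EssBdd.integrable_trace {F : Circle → Matrix (Fin p) (Fin p) ℂ} (hF : EssBdd F) :
    Integrable (fun z => (F z).trace) circleMeasure :=
  integrable_finsetSum _ fun i _ => hF.integrable i i

theorem EssBdd.integrable_trace_re {F : Circle → Matrix (Fin p) (Fin p) ℂ} (hF : EssBdd F) :
    Integrable (fun z => (F z).trace.re) circleMeasure := hF.integrable_trace.re

theorem EssBdd.trace_mul_integral {F : Circle → Matrix (Fin p) (Fin q) ℂ} (hF : EssBdd F)
    (C : Matrix (Fin q) (Fin p) ℂ) :
    (C * Matrix.of fun i j => ∫ z, F z i j ∂circleMeasure).trace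
      = ∫ z, (C * F z).trace ∂circleMeasure := by
  simp only [Matrix.trace, diag_apply, Matrix.mul_apply, of_apply]
  rw [integral_finsetSum]
  · refine Finset.sum_congr rfl fun i _ => ?_
    rw [integral_finsetSum _ fun k _ => (hF.integrable k i).const_mul _]
    exact Finset.sum_congr rfl fun k _ => (integral_const_mul _ _).symm
  · exact fun i _ => integrable_finsetSum _ fun k _ => (hF.integrable k i).const_mul _

end Bounded

/-! ### The transfer function, the operator `Γ` and its adjoint. -/

section Transfer

variable {n m : ℕ} {A : Matrix (Fin n) (Fin n) ℝ} {B : Matrix (Fin n) (Fin m) ℝ}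

theorem IsStable.isUnit_det (hA : IsStable A) {w : ℂ} (hw : 1 ≤ ‖w‖) :
    IsUnit (w • (1 : Matrix (Fin n) (Fin n) ℂ) - toC A).det := by
  rw [← Matrix.isUnit_iff_isUnit_det]
  by_contra h
  refine absurd (hA w ?_) hw.not_gt
  rwa [spectrum.mem_iff, Algebra.algebraMap_eq_smul_one]

theorem IsStable.isUnit_det_circle (hA : IsStable A) (z : Circle) :
    IsUnit ((z : ℂ) • (1 : Matrix (Fin n) (Fin n) ℂ) - toC A).det :=
  hA.isUnit_det z.norm_coe.ge

theorem continuous_inv_of_isUnit {X : Type*} [TopologicalSpace X] {p : ℕ}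
    {F : X → Matrix (Fin p) (Fin p) ℂ}
    (hF : Continuous F) (h : ∀ z, IsUnit (F z).det) : Continuous fun z => (F z)⁻¹ :=
  continuous_iff_continuousAt.mpr fun z =>
    (continuousAt_matrix_inv _ (NormedRing.inverse_continuousAt (h z).unit)).comp hF.continuousAt

theorem continuous_resolvent (hA : IsStable A) :
    Continuous fun z : Circle => ((z : ℂ) • (1 : Matrix (Fin n) (Fin n) ℂ) - toC A)⁻¹ :=
  continuous_inv_of_isUnit (by fun_prop) hA.isUnit_det_circle

theorem continuous_G (hA : IsStable A) : Continuous (G A B) :=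
  (continuous_resolvent hA).matrix_mul continuous_const

theorem conjSymm_resolvent :
    ConjSymm fun z : Circle => ((z : ℂ) • (1 : Matrix (Fin n) (Fin n) ℂ) - toC A)⁻¹ :=
  (ConjSymm.coe_smul_one.sub (ConjSymm.toC A)).inv

theorem conjSymm_G : ConjSymm (G A B) := conjSymm_resolvent.mul (ConjSymm.toC B)

/-- `G^* M G` on the unit circle. -/
def hG (A : Matrix (Fin n) (Fin n) ℝ) (B : Matrix (Fin n) (Fin m) ℝ)
    (M : Matrix (Fin n) (Fin n) ℝ) (z : Circle) : Matrix (Fin m) (Fin m) ℂ :=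
  (G A B z)ᴴ * toC M * G A B z

theorem continuous_hG (hA : IsStable A) (M : Matrix (Fin n) (Fin n) ℝ) :
    Continuous (hG A B M) :=
  ((continuous_G hA).matrix_conjTranspose.matrix_mul continuous_const).matrix_mul (continuous_G hA)

theorem conjSymm_hG (M : Matrix (Fin n) (Fin n) ℝ) : ConjSymm (hG A B M) :=
  (conjSymm_G.conjTranspose.mul (ConjSymm.toC M)).mul conjSymm_G

theorem isHermitian_hG {M : Matrix (Fin n) (Fin n) ℝ} (hM : M.IsSymm) (z : Circle) :
    (hG A B M z).IsHermitian := by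
  simp only [IsHermitian, hG, conjTranspose_mul, conjTranspose_conjTranspose, ← toC_transpose,
    hM.eq, Matrix.mul_assoc]

theorem hG_add (M N : Matrix (Fin n) (Fin n) ℝ) (z : Circle) :
    hG A B (M + N) z = hG A B M z + hG A B N z := by
  simp only [hG, toC_add, Matrix.mul_add, Matrix.add_mul]

theorem hG_sub (M N : Matrix (Fin n) (Fin n) ℝ) (z : Circle) :
    hG A B (M - N) z = hG A B M z - hG A B N z := by
  simp only [hG, toC_sub, Matrix.mul_sub, Matrix.sub_mul]

theorem hG_smul (c : ℝ) (M : Matrix (Fin n) (Fin n) ℝ) (z : Circle) :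
    hG A B (c • M) z = (c : ℂ) • hG A B M z := by
  simp only [hG, toC_smul, Matrix.mul_smul, Matrix.smul_mul]

/-- For the trace pairings, `M ↦ G^* M G` is the adjoint of `Γ`; this identity links the primal and
dual problems. -/
theorem trace_mul_moment (hA : IsStable A) {Φ : Circle → Matrix (Fin m) (Fin m) ℂ}
    (hΦ : EssBdd Φ) (M : Matrix (Fin n) (Fin n) ℝ) :
    (toC M * moment A B Φ).trace.re = ∫ z, (hG A B M z * Φ z).trace.re ∂circleMeasure := by
  have hG' := EssBdd.of_continuous (continuous_G (B := B) hA)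
  have hGh := EssBdd.of_continuous (continuous_G (B := B) hA).matrix_conjTranspose
  have h1 : EssBdd fun z => G A B z * Φ z * (G A B z)ᴴ := (hG'.mul hΦ).mul hGh
  have h2 : EssBdd fun z => hG A B M z * Φ z :=
    (EssBdd.of_continuous (continuous_hG hA M)).mul hΦ
  have h3 : ∫ z, (hG A B M z * Φ z).trace.re ∂circleMeasure
      = (∫ z, (hG A B M z * Φ z).trace ∂circleMeasure).re :=
    integral_re h2.integrable_trace
  rw [moment, h1.trace_mul_integral, h3]
  congr 2
  funext z
  rw [hG, ← Matrix.mul_assoc, Matrix.trace_mul_comm]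
  simp only [Matrix.mul_assoc]

theorem trace_mul_eq_integral (hA : IsStable A) {Φ : Circle → Matrix (Fin m) (Fin m) ℂ}
    (hΦ : EssBdd Φ) {S : Matrix (Fin n) (Fin n) ℝ} (hS : moment A B Φ = toC S)
    (M : Matrix (Fin n) (Fin n) ℝ) :
    (M * S).trace = ∫ z, (hG A B M z * Φ z).trace.re ∂circleMeasure := by
  rw [← trace_mul_moment hA hΦ, hS, ← toC_mul, toC_trace_re]

theorem moment_add (hA : IsStable A) {Φ Φ' : Circle → Matrix (Fin m) (Fin m) ℂ}
    (hΦ : EssBdd Φ) (hΦ' : EssBdd Φ') :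
    moment A B (Φ + Φ') = moment A B Φ + moment A B Φ' := by
  have hG' := EssBdd.of_continuous (continuous_G (B := B) hA)
  have hGh := EssBdd.of_continuous (continuous_G (B := B) hA).matrix_conjTranspose
  ext i j
  simp only [moment, of_apply, Matrix.add_apply]
  rw [← integral_add (((hG'.mul hΦ).mul hGh).integrable i j)
    (((hG'.mul hΦ').mul hGh).integrable i j)]
  simp only [Pi.add_apply, Matrix.mul_add, Matrix.add_mul, Matrix.add_apply]

theorem moment_smul (c : ℝ) (Φ : Circle → Matrix (Fin m) (Fin m) ℂ) :
    moment A B (c • Φ) = (c : ℂ) • moment A B Φ := by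
  ext i j
  simp only [moment, of_apply, Matrix.smul_apply, Pi.smul_apply, Matrix.mul_smul, Matrix.smul_mul]
  rw [integral_smul]; simp

theorem moment_zero : moment A B (0 : Circle → Matrix (Fin m) (Fin m) ℂ) = 0 := by
  ext i j; simp [moment]

theorem contDensitySpan_prop {Φ : Circle → Matrix (Fin m) (Fin m) ℂ}
    (hΦ : Φ ∈ contDensitySpan m) :
    Continuous Φ ∧ ∀ z, (Φ z).IsHermitian := by
  induction hΦ using Submodule.span_induction with
  | mem Φ h => exact ⟨h.continuous, fun z => (h.posSemidef z).1⟩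
  | zero => exact ⟨continuous_const, fun z => isHermitian_zero⟩
  | add Φ Φ' _ _ h h' => exact ⟨h.1.add h'.1, fun z => (h.2 z).add (h'.2 z)⟩
  | smul c Φ _ h => exact ⟨h.1.const_smul c, fun z => by
      rw [IsHermitian, Pi.smul_apply, conjTranspose_smul, (h.2 z).eq]; simp⟩

/-- The range of `Γ` as a real subspace. -/
def rangeSub (hA : IsStable A) (B : Matrix (Fin n) (Fin m) ℝ) :
    Submodule ℝ (Matrix (Fin n) (Fin n) ℝ) where
  carrier := rangeGamma A B
  add_mem' := by
    rintro M N ⟨Φ, hΦ, hM⟩ ⟨Φ', hΦ', hN⟩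
    refine ⟨Φ + Φ', add_mem hΦ hΦ', ?_⟩
    rw [moment_add hA (.of_continuous (contDensitySpan_prop hΦ).1)
      (.of_continuous (contDensitySpan_prop hΦ').1), toC_add, hM, hN]
  zero_mem' := ⟨0, zero_mem _, by rw [toC_zero, moment_zero]⟩
  smul_mem' := by
    rintro c M ⟨Φ, hΦ, hM⟩
    exact ⟨c • Φ, Submodule.smul_mem _ c hΦ, by rw [moment_smul, toC_smul, hM]⟩

theorem isSymm_of_mem_rangeGamma {M : Matrix (Fin n) (Fin n) ℝ} (hM : M ∈ rangeGamma A B) :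
    M.IsSymm := by
  obtain ⟨Φ, hΦ, h⟩ := hM
  refine toC_injective ?_
  rw [toC_transpose, h]
  ext i j
  simp only [moment, conjTranspose_apply, of_apply]
  rw [RCLike.star_def, ← integral_conj]
  congr 1; funext z
  rw [← RCLike.star_def, ← conjTranspose_apply]
  simp only [conjTranspose_mul, conjTranspose_conjTranspose, ((contDensitySpan_prop hΦ).2 z).eq,
    Matrix.mul_assoc]

/-- A continuous positive density has its moment in the range of `Γ`. -/
theorem exists_mem_rangeGamma {Φ : Circle → Matrix (Fin m) (Fin m) ℂ}
    (hc : Continuous Φ) (hs : ConjSymm Φ) (hp : ∀ z, (Φ z).PosSemidef) :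
    IsContDensity Φ ∧ ∃ M ∈ rangeGamma A B, toC M = moment A B Φ := by
  have hΦ : IsContDensity Φ := ⟨hc, fun z => by rw [hs z, (hp z).1.eq], hp⟩
  obtain ⟨M, hM⟩ := ((conjSymm_G (A := A) (B := B)).mul hs |>.mul
    conjSymm_G.conjTranspose).exists_toC_integral
  exact ⟨hΦ, M, ⟨Φ, Submodule.subset_span hΦ, hM⟩, hM⟩

/-- `G^* M G` vanishes identically only for `M = 0` in the range of `Γ`. -/
theorem eq_zero_of_hG_eq_zero (hA : IsStable A) {M : Matrix (Fin n) (Fin n) ℝ}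
    (hM : M ∈ rangeGamma A B) (h : ∀ z, hG A B M z = 0) : M = 0 := by
  obtain ⟨Φ, hΦ, hMΦ⟩ := id hM
  -- Write `M = Γ(Φ)` and pair `M` with itself: `tr(M²) = ∫ tr(G^* M G Φ) = 0`, and `M` is
  -- symmetric.
  have h1 := trace_mul_eq_integral hA (.of_continuous (contDensitySpan_prop hΦ).1) hMΦ.symm M
  simp only [h, Matrix.zero_mul, trace_zero, Complex.zero_re, integral_zero] at h1
  have h2 : (Mᴴ * M).trace = 0 := by
    rw [← h1]; congr 2
    rw [conjTranspose_eq_transpose_of_trivial, (isSymm_of_mem_rangeGamma hM).eq]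
  exact trace_conjTranspose_mul_self_eq_zero_iff.mp h2

end Transfer

/-! ### Entrywise differentiability of matrix functions. -/

section Differentiability

variable {𝕜 : Type*} [NontriviallyNormedField 𝕜] [NormedAlgebra 𝕜 ℂ] {p q r : ℕ} {x : 𝕜}

/-- The field is kept general: `ℂ` serves the mean value property of the resolvent, `ℝ` the
dependence on the angle. -/
theorem differentiableAt_matrix_mul {F : 𝕜 → Matrix (Fin p) (Fin q) ℂ}
    {H : 𝕜 → Matrix (Fin q) (Fin r) ℂ}
    (hF : ∀ i j, DifferentiableAt 𝕜 (fun t => F t i j) x)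
    (hH : ∀ i j, DifferentiableAt 𝕜 (fun t => H t i j) x) (i j) :
    DifferentiableAt 𝕜 (fun t => (F t * H t) i j) x := by
  simp only [Matrix.mul_apply]
  exact DifferentiableAt.fun_sum fun k _ => (hF i k).mul (hH k j)

theorem differentiableAt_matrix_det {F : 𝕜 → Matrix (Fin p) (Fin p) ℂ}
    (hF : ∀ i j, DifferentiableAt 𝕜 (fun t => F t i j) x) :
    DifferentiableAt 𝕜 (fun t => (F t).det) x := by
  simp only [Matrix.det_apply']
  exact DifferentiableAt.fun_sum fun σ _ =>
    (DifferentiableAt.fun_finsetProd fun k _ => hF _ _).const_mul _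

theorem differentiableAt_matrix_inv {F : 𝕜 → Matrix (Fin p) (Fin p) ℂ}
    (hF : ∀ i j, DifferentiableAt 𝕜 (fun t => F t i j) x) (hx : IsUnit (F x).det) (i j) :
    DifferentiableAt 𝕜 (fun t => (F t)⁻¹ i j) x := by
  simp only [Matrix.inv_def, Matrix.smul_apply, Ring.inverse_eq_inv', smul_eq_mul,
    Matrix.adjugate_apply]
  refine ((differentiableAt_matrix_det hF).inv hx.ne_zero).mul
    (differentiableAt_matrix_det fun k l => ?_)
  by_cases hk : k = j
  · simp [hk]
  · simpa [Matrix.updateRow_ne hk] using hF k l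

end Differentiability

/-! ### A continuous positive density with the prescribed covariance. -/

section Feasible

variable {n m : ℕ} {A : Matrix (Fin n) (Fin n) ℝ} {B : Matrix (Fin n) (Fin m) ℝ}

theorem mulVec_injective_of_rank (hB : B.rank = m) : Function.Injective B.mulVec := by
  have h := LinearMap.finrank_range_add_finrank_ker B.mulVecLin
  rw [← Matrix.rank, hB, Module.finrank_fin_fun] at h
  have h2 : LinearMap.ker B.mulVecLin = ⊥ := Submodule.finrank_eq_zero.mp (by omega)
  exact LinearMap.ker_eq_bot.mp h2

/-- With `K = S⁻¹`, the matrix `P = 1 - B R Bᵀ K` is a projection that kills `B`, and the feedback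
turns `A` into `P A`. In `P (A S Aᵀ) Pᵀ` the terms with `H` therefore vanish, leaving `P S Pᵀ = S -
B R Bᵀ`. -/
theorem lyapunov_feedback {S K : Matrix (Fin n) (Fin n) ℝ} {R : Matrix (Fin m) (Fin m) ℝ}
    {H : Matrix (Fin m) (Fin n) ℝ} (hK : K * S = 1) (hK' : Kᵀ = K) (hR : R * (Bᵀ * K * B) = 1)
    (hR' : Rᵀ = R) (hH : S - A * S * Aᵀ = B * H + Hᵀ * Bᵀ) :
    S - (A + B * (-(R * Bᵀ * K * A))) * S * (A + B * (-(R * Bᵀ * K * A)))ᵀ = B * R * Bᵀ := by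
  set P : Matrix (Fin n) (Fin n) ℝ := 1 - B * R * Bᵀ * K with hP
  have hAc : A + B * (-(R * Bᵀ * K * A)) = P * A := by
    rw [hP, Matrix.sub_mul, Matrix.one_mul, Matrix.mul_neg, ← sub_eq_add_neg]
    simp only [Matrix.mul_assoc]
  have hPB : P * B = 0 := by
    have : B * R * Bᵀ * K * B = B * (R * (Bᵀ * K * B)) := by simp only [Matrix.mul_assoc]
    rw [hP, Matrix.sub_mul, Matrix.one_mul, this, hR, Matrix.mul_one, sub_self]
  have hBP : Bᵀ * Pᵀ = 0 := by rw [← transpose_mul, hPB, transpose_zero]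
  have hPS : P * S = S - B * R * Bᵀ := by
    rw [hP, Matrix.sub_mul, Matrix.one_mul, Matrix.mul_assoc _ K S, hK, Matrix.mul_one]
  clear_value P
  have hASA : A * S * Aᵀ = S - B * H - Hᵀ * Bᵀ := by
    rw [sub_eq_iff_eq_add] at hH
    rw [eq_sub_iff_add_eq, eq_sub_iff_add_eq]
    nth_rewrite 2 [hH]
    abel
  have h1 : P * A * S * (P * A)ᵀ = P * (A * S * Aᵀ) * Pᵀ := by
    rw [transpose_mul]; simp only [Matrix.mul_assoc]
  have h2 : P * (B * H) = 0 := by rw [← Matrix.mul_assoc, hPB, Matrix.zero_mul]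
  have h3 : P * (Hᵀ * Bᵀ) * Pᵀ = 0 := by
    rw [Matrix.mul_assoc, Matrix.mul_assoc, hBP, Matrix.mul_zero, Matrix.mul_zero]
  have h4 : B * R * Bᵀ * Pᵀ = 0 := by rw [Matrix.mul_assoc, hBP, Matrix.mul_zero]
  have h5 : S * Pᵀ = S - B * R * Bᵀ := by
    have hS' : Sᵀ = S := by
      have h := congrArg Matrix.transpose hK
      rw [transpose_mul, hK', transpose_one] at h
      exact left_inv_eq_right_inv h hK
    have hsym : (B * R * Bᵀ)ᵀ = B * R * Bᵀ := by
      rw [transpose_mul, transpose_mul, transpose_transpose, hR', Matrix.mul_assoc]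
    have := congrArg Matrix.transpose hPS
    rwa [transpose_mul, hS', transpose_sub, hS', hsym] at this
  rw [hAc, h1, hASA, Matrix.mul_sub, Matrix.mul_sub, h2, sub_zero, Matrix.sub_mul, h3, sub_zero,
    hPS, Matrix.sub_mul, h4, h5, sub_zero, sub_sub_cancel]

/-- A Lyapunov argument: the feedback matrix is stable. -/
theorem isStable_feedback {S : Matrix (Fin n) (Fin n) ℝ} {R : Matrix (Fin m) (Fin m) ℝ}
    {F : Matrix (Fin m) (Fin n) ℝ} (hA : IsStable A) (hS : S.PosDef) (hR : R.PosDef)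
    (h : S - (A + B * F) * S * (A + B * F)ᵀ = B * R * Bᵀ) : IsStable (A + B * F) := by
  intro μ hμ
  by_contra! hμ1
  set D := toC (A + B * F) with hD
  rw [spectrum.mem_iff, Algebra.algebraMap_eq_smul_one, Matrix.isUnit_iff_isUnit_det,
    isUnit_iff_ne_zero, not_not] at hμ
  have hdet : ((μ • (1 : Matrix (Fin n) (Fin n) ℂ) - D)ᴴ).det = 0 := by
    rw [det_conjTranspose, hμ, star_zero]
  obtain ⟨v, hv, hv0⟩ := exists_mulVec_eq_zero_iff.mpr hdet
  have hDv : Dᴴ *ᵥ v = star μ • v := by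
    rw [conjTranspose_sub, conjTranspose_smul, conjTranspose_one, sub_mulVec, smul_mulVec,
      one_mulVec, sub_eq_zero] at hv0
    exact hv0.symm
  have hC : toC S - D * toC S * Dᴴ = toC B * toC R * (toC B)ᴴ := by
    rw [hD, ← toC_transpose, ← toC_mul, ← toC_mul, ← toC_sub, h, ← toC_transpose, toC_mul, toC_mul]
  have hq : ∀ {k : ℕ} (C : Matrix (Fin n) (Fin k) ℂ) (X : Matrix (Fin k) (Fin k) ℂ),
      star v ⬝ᵥ ((C * X * Cᴴ) *ᵥ v) = star (Cᴴ *ᵥ v) ⬝ᵥ (X *ᵥ (Cᴴ *ᵥ v)) := by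
    intro k C X
    rw [star_mulVec, conjTranspose_conjTranspose, ← dotProduct_mulVec, mulVec_mulVec,
      mulVec_mulVec, Matrix.mul_assoc]
  -- The Lyapunov equation on a left eigenvector: `(1 - |μ|²) v^* S v = (B^* v)^* R (B^* v)`. If
  -- `|μ| ≥ 1`, this forces `B^* v = 0`, so the feedback is invisible to `v` and `μ` is already an
  -- eigenvalue of `A`.
  have h1 : (star v ⬝ᵥ (toC S *ᵥ v)).re - ‖μ‖ ^ 2 * (star v ⬝ᵥ (toC S *ᵥ v)).re
      = (star ((toC B)ᴴ *ᵥ v) ⬝ᵥ (toC R *ᵥ ((toC B)ᴴ *ᵥ v))).re := by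
    have h2 := congrArg (fun X => (star v ⬝ᵥ (X *ᵥ v)).re) hC
    simp only [sub_mulVec, dotProduct_sub, hq, hDv, Complex.sub_re] at h2
    rw [← h2, mulVec_smul, star_smul, star_star, smul_dotProduct, dotProduct_smul, smul_smul,
      smul_eq_mul, RCLike.star_def, Complex.mul_conj, Complex.re_ofReal_mul,
      Complex.normSq_eq_norm_sq]
  have hSv : 0 < (star v ⬝ᵥ (toC S *ᵥ v)).re := (posDef_toC hS).re_dotProduct_pos hv
  have hle : (star ((toC B)ᴴ *ᵥ v) ⬝ᵥ (toC R *ᵥ ((toC B)ᴴ *ᵥ v))).re ≤ 0 := by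
    rw [← h1]
    nlinarith [mul_nonneg (show 0 ≤ ‖μ‖ ^ 2 - 1 by nlinarith) hSv.le]
  have hBv : (toC B)ᴴ *ᵥ v = 0 := by
    by_contra hne
    exact hle.not_gt ((posDef_toC hR).re_dotProduct_pos hne)
  have hAv : (toC A)ᴴ *ᵥ v = star μ • v := by
    rw [← hDv, hD, toC_add, toC_mul, conjTranspose_add, conjTranspose_mul, add_mulVec,
      ← mulVec_mulVec, hBv, mulVec_zero, add_zero]
  have hz : ((μ • (1 : Matrix (Fin n) (Fin n) ℂ) - toC A)ᴴ).det = 0 :=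
    exists_mulVec_eq_zero_iff.mp ⟨v, hv, by
      rw [conjTranspose_sub, conjTranspose_smul, conjTranspose_one, sub_mulVec, smul_mulVec,
        one_mulVec, hAv, sub_self]⟩
  rw [det_conjTranspose, star_eq_zero] at hz
  exact (hA.isUnit_det hμ1).ne_zero hz

/-- After `z ↦ z⁻¹` the resolvent becomes `w (1 - wA)⁻¹`, holomorphic on the closed disc by
stability and zero at the centre. -/
theorem integral_resolvent_mul (hA : IsStable A) (C : Matrix (Fin n) (Fin n) ℂ) (i j : Fin n) :
    ∫ z : Circle, (((z : ℂ) • (1 : Matrix (Fin n) (Fin n) ℂ) - toC A)⁻¹ * C) i j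
      ∂circleMeasure = 0 := by
  set f : ℂ → ℂ := fun w => ((w • (1 - w • toC A)⁻¹) * C) i j with hf
  have hu : ∀ w : ℂ, ‖w‖ ≤ 1 → IsUnit (1 - w • toC A).det := by
    intro w hw
    rcases eq_or_ne w 0 with rfl | h0
    · simp
    · have h1 : (1 : Matrix (Fin n) (Fin n) ℂ) - w • toC A
          = w • (w⁻¹ • (1 : Matrix (Fin n) (Fin n) ℂ) - toC A) := by
        rw [smul_sub, smul_smul, mul_inv_cancel₀ h0, one_smul]
      rw [h1, det_smul]
      refine ((isUnit_iff_ne_zero.mpr h0).pow _).mul (hA.isUnit_det ?_)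
      rw [norm_inv]
      exact (one_le_inv₀ (norm_pos_iff.mpr h0)).mpr hw
  have hd : ∀ w : ℂ, ‖w‖ ≤ 1 → DifferentiableAt ℂ f w := by
    intro w hw
    refine differentiableAt_matrix_mul (F := fun w : ℂ => w • (1 - w • toC A)⁻¹)
      (H := fun _ : ℂ => C)
      (fun k l => ?_) (fun k l => differentiableAt_const (C k l)) i j
    simp only [Matrix.smul_apply, smul_eq_mul]
    refine differentiableAt_id.mul (differentiableAt_matrix_inv
      (F := fun w : ℂ => 1 - w • toC A) (fun a b => ?_) (hu w hw) k l)
    simp only [Matrix.sub_apply, Matrix.smul_apply, smul_eq_mul]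
    fun_prop
  have h0 : f 0 = 0 := by simp [hf]
  rw [← integral_inv_circle, ← h0, ← integral_circle_eq_center hd]
  congr 1; funext z
  have hz : (z : ℂ) ≠ 0 := z.coe_ne_zero
  have h1 : (((z⁻¹ : Circle) : ℂ) • (1 : Matrix (Fin n) (Fin n) ℂ) - toC A)⁻¹
      = (z : ℂ) • (1 - (z : ℂ) • toC A)⁻¹ := by
    refine Matrix.inv_eq_right_inv ?_
    rw [Circle.coe_inv, Matrix.mul_smul, ← Matrix.smul_mul, smul_sub, smul_smul,
      mul_inv_cancel₀ hz, one_smul, Matrix.mul_nonsing_inv _ (hu z z.norm_coe.le)]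
  rw [h1]

/-- The spectral integral solving a discrete Lyapunov equation. -/
theorem integral_resolvent_lyapunov (hA : IsStable A) {S D : Matrix (Fin n) (Fin n) ℂ}
    (hS : S.IsHermitian) (h : S - toC A * S * (toC A)ᴴ = D) (i j : Fin n) :
    ∫ z : Circle, (((z : ℂ) • (1 : Matrix (Fin n) (Fin n) ℂ) - toC A)⁻¹ * D *
      (((z : ℂ) • (1 : Matrix (Fin n) (Fin n) ℂ) - toC A)⁻¹)ᴴ) i j ∂circleMeasure = S i j := by
  set T : Circle → Matrix (Fin n) (Fin n) ℂ := fun z =>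
    ((z : ℂ) • (1 : Matrix (Fin n) (Fin n) ℂ) - toC A)⁻¹ * (toC A * S) with hT
  have key : ∀ z : Circle, ((z : ℂ) • (1 : Matrix (Fin n) (Fin n) ℂ) - toC A)⁻¹ * D *
      (((z : ℂ) • (1 : Matrix (Fin n) (Fin n) ℂ) - toC A)⁻¹)ᴴ = S + T z + (T z)ᴴ := by
    intro z
    set Z : Matrix (Fin n) (Fin n) ℂ := (z : ℂ) • (1 : Matrix (Fin n) (Fin n) ℂ) - toC A with hZ
    have hu : IsUnit Z.det := hA.isUnit_det_circle z
    have hi : Z⁻¹ * Z = 1 := nonsing_inv_mul _ hu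
    have hi' : Zᴴ * (Z⁻¹)ᴴ = 1 := by rw [← conjTranspose_mul, hi, conjTranspose_one]
    have hAz : toC A = (z : ℂ) • (1 : Matrix (Fin n) (Fin n) ℂ) - Z := by rw [hZ]; abel
    have hzz : (z : ℂ) * (starRingEnd ℂ) (z : ℂ) = 1 := by
      rw [Complex.mul_conj, Circle.normSq_coe, Complex.ofReal_one]
    -- Since `|z| = 1`, `S = (zI) S (zI)^*`; expand with `zI = Z + A`. The integrand becomes `S + T
    -- + T^*`, and `T` has integral zero.
    have hD : D = Z * S * Zᴴ + toC A * S * Zᴴ + Z * S * (toC A)ᴴ := by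
      rw [← h, hAz]
      simp only [conjTranspose_sub, conjTranspose_smul, conjTranspose_one, Matrix.sub_mul,
        Matrix.mul_sub, Matrix.smul_mul, Matrix.mul_smul, Matrix.one_mul, Matrix.mul_one, smul_sub,
        smul_smul, RCLike.star_def]
      rw [mul_comm, hzz, one_smul]
      abel
    have e1 : Z⁻¹ * (Z * S * Zᴴ) * (Z⁻¹)ᴴ = S := by
      rw [Matrix.mul_assoc Z, ← Matrix.mul_assoc Z⁻¹, hi, Matrix.one_mul, Matrix.mul_assoc, hi',
        Matrix.mul_one]
    have e2 : Z⁻¹ * (toC A * S * Zᴴ) * (Z⁻¹)ᴴ = T z := by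
      rw [Matrix.mul_assoc, Matrix.mul_assoc (toC A * S), hi', Matrix.mul_one]
    have e3 : Z⁻¹ * (Z * S * (toC A)ᴴ) * (Z⁻¹)ᴴ = (T z)ᴴ := by
      rw [Matrix.mul_assoc Z, ← Matrix.mul_assoc Z⁻¹, hi, Matrix.one_mul, hT]
      simp only [conjTranspose_mul, hS.eq, ← hZ]
    rw [hD, Matrix.mul_add, Matrix.mul_add, Matrix.add_mul, Matrix.add_mul, e1, e2, e3]
  have hTc : Continuous T := (continuous_resolvent hA).matrix_mul continuous_const
  simp only [key, Matrix.add_apply]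
  rw [integral_add, integral_add, integral_resolvent_mul hA]
  · have : ∫ z, (T z)ᴴ i j ∂circleMeasure = 0 := by
      simp only [conjTranspose_apply, RCLike.star_def]
      rw [integral_conj, integral_resolvent_mul hA, map_zero]
    rw [this]; simp
  · exact integrable_const _
  · exact integrable_of_continuous (hTc.matrix_elem i j)
  · exact integrable_of_continuous (continuous_const.add (hTc.matrix_elem i j))
  · exact integrable_of_continuous (hTc.matrix_conjTranspose.matrix_elem i j)

/-- Under the covariance equation there is a continuous positive definite density matching the
state covariance. -/
theorem exists_density {S : Matrix (Fin n) (Fin n) ℝ} (hA : IsStable A) (hB : B.rank = m)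
    (hS : S.PosDef)
    (hfeas : ∃ H : Matrix (Fin m) (Fin n) ℝ, S - A * S * Aᵀ = B * H + Hᵀ * Bᵀ) :
    ∃ Φ : Circle → Matrix (Fin m) (Fin m) ℂ, Continuous Φ ∧ ConjSymm Φ ∧ (∀ z, (Φ z).PosDef) ∧
      moment A B Φ = toC S := by
  obtain ⟨H, hH⟩ := hfeas
  have hSi := hS.inv
  have hR : (Bᵀ * S⁻¹ * B).PosDef := by
    rw [← conjTranspose_eq_transpose_of_trivial]
    exact hSi.conjTranspose_mul_mul_same (mulVec_injective_of_rank hB)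
  set R := (Bᵀ * S⁻¹ * B)⁻¹ with hRdef
  have hRp : R.PosDef := hR.inv
  set F : Matrix (Fin m) (Fin n) ℝ := -(R * Bᵀ * S⁻¹ * A) with hF
  have hly : S - (A + B * F) * S * (A + B * F)ᵀ = B * R * Bᵀ := by
    refine lyapunov_feedback (nonsing_inv_mul _ hS.det_pos.ne'.isUnit) ?_
      (nonsing_inv_mul _ hR.det_pos.ne'.isUnit) ?_ hH
    · rw [← conjTranspose_eq_transpose_of_trivial]; exact hSi.1
    · rw [← conjTranspose_eq_transpose_of_trivial]; exact hRp.1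
  have hAc := isStable_feedback hA hS hRp hly
  set Zi : Circle → Matrix (Fin n) (Fin n) ℂ := fun z =>
    ((z : ℂ) • (1 : Matrix (Fin n) (Fin n) ℂ) - toC (A + B * F))⁻¹ with hZi
  have hZic : Continuous Zi := continuous_resolvent hAc
  -- `N` is the transfer function of the feedback loop: `G N` is the transfer function of `(A + BF,
  -- B)`, so the density `N R N^*` has as its moment the Lyapunov integral of the closed loop, that
  -- is `S`.
  set N : Circle → Matrix (Fin m) (Fin m) ℂ := fun z => 1 + toC F * Zi z * toC B with hN
  have hNc : Continuous N := continuous_const.add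
    ((continuous_const.matrix_mul hZic).matrix_mul continuous_const)
  have hres : ∀ z : Circle, Zi z - ((z : ℂ) • (1 : Matrix (Fin n) (Fin n) ℂ) - toC A)⁻¹
      = ((z : ℂ) • (1 : Matrix (Fin n) (Fin n) ℂ) - toC A)⁻¹ * (toC B * toC F) * Zi z := by
    intro z
    have h1 := hAc.isUnit_det_circle z
    have h2 := hA.isUnit_det_circle z
    have h3 : toC B * toC F = ((z : ℂ) • (1 : Matrix (Fin n) (Fin n) ℂ) - toC A) -
        ((z : ℂ) • (1 : Matrix (Fin n) (Fin n) ℂ) - toC (A + B * F)) := by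
      rw [toC_add, toC_mul]; abel
    rw [h3, Matrix.mul_sub, nonsing_inv_mul _ h2, Matrix.sub_mul, Matrix.one_mul,
      Matrix.mul_assoc, mul_nonsing_inv _ h1, Matrix.mul_one]
  have hGN : ∀ z, G A B z * N z = Zi z * toC B := by
    intro z
    rw [hN, G]
    beta_reduce
    rw [Matrix.mul_add, Matrix.mul_one]
    rw [show Zi z * toC B = (((z : ℂ) • (1 : Matrix (Fin n) (Fin n) ℂ) - toC A)⁻¹ +
      (Zi z - ((z : ℂ) • (1 : Matrix (Fin n) (Fin n) ℂ) - toC A)⁻¹)) * toC B by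
        rw [add_sub_cancel], hres z]
    simp only [Matrix.add_mul, Matrix.mul_assoc]
  have hNu : ∀ z, IsUnit (N z) := by
    intro z
    -- The open-loop expression `1 - F G` inverts `N`, so the density is positive definite
    -- everywhere.
    have h1 : (1 - toC F * G A B z) * N z = 1 := by
      rw [Matrix.sub_mul, Matrix.one_mul, Matrix.mul_assoc, hGN, hN]
      simp only [Matrix.mul_assoc, add_sub_cancel_right]
    exact IsUnit.of_mul_eq_one_right _ h1
  refine ⟨fun z => N z * toC R * (N z)ᴴ, (hNc.matrix_mul continuous_const).matrix_mul
    hNc.matrix_conjTranspose, ?_, fun z => ?_, ?_⟩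
  · have hNs : ConjSymm N := ConjSymm.one.add
      (((ConjSymm.toC F).mul conjSymm_resolvent).mul (ConjSymm.toC B))
    exact (hNs.mul (ConjSymm.toC R)).mul hNs.conjTranspose
  · exact (posDef_toC hRp).mul_mul_conjTranspose_same (Matrix.vecMul_injective_of_isUnit (hNu z))
  · ext i j
    rw [← integral_resolvent_lyapunov hAc (S := toC S) (D := toC (B * R * Bᵀ)) ?_ ?_ i j]
    · simp only [moment, of_apply]
      congr 1; funext z
      have : G A B z * (N z * toC R * (N z)ᴴ) * (G A B z)ᴴ
          = Zi z * toC (B * R * Bᵀ) * (Zi z)ᴴ := by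
        rw [show G A B z * (N z * toC R * (N z)ᴴ) * (G A B z)ᴴ
          = (G A B z * N z) * toC R * (G A B z * N z)ᴴ by
            simp only [conjTranspose_mul, Matrix.mul_assoc], hGN, toC_mul, toC_mul, toC_transpose]
        simp only [conjTranspose_mul, Matrix.mul_assoc]
      rw [this]
    · exact (posDef_toC hS).1
    · rw [← hly, toC_sub, toC_mul, toC_mul, toC_transpose]

end Feasible

/-! ### Quadratic forms on compact spheres and the integrated tangent inequality. -/

section Compactness

variable {m : ℕ}

/-- The real quadratic form of a matrix. -/
def quad (X : Matrix (Fin m) (Fin m) ℂ) (v : Fin m → ℂ) : ℝ := (star v ⬝ᵥ (X *ᵥ v)).re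

theorem quad_smul_vec (X : Matrix (Fin m) (Fin m) ℂ) (c : ℝ) (v : Fin m → ℂ) :
    quad X ((c : ℂ) • v) = c ^ 2 * quad X v := by
  simp only [quad, mulVec_smul, star_smul, smul_dotProduct, dotProduct_smul, smul_eq_mul,
    RCLike.star_def, Complex.conj_ofReal, Complex.re_ofReal_mul]
  ring

theorem quad_add (X Y : Matrix (Fin m) (Fin m) ℂ) (v : Fin m → ℂ) :
    quad (X + Y) v = quad X v + quad Y v := by
  simp [quad, add_mulVec, dotProduct_add]

theorem quad_sub (X Y : Matrix (Fin m) (Fin m) ℂ) (v : Fin m → ℂ) :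
    quad (X - Y) v = quad X v - quad Y v := by
  simp [quad, sub_mulVec, dotProduct_sub]

theorem quad_smul (c : ℝ) (X : Matrix (Fin m) (Fin m) ℂ) (v : Fin m → ℂ) :
    quad ((c : ℂ) • X) v = c * quad X v := by
  simp only [quad, smul_mulVec, dotProduct_smul, smul_eq_mul, Complex.re_ofReal_mul]

theorem exists_sphere_smul {v : Fin m → ℂ} (hv : v ≠ 0) :
    ∃ (c : ℝ) (u : Metric.sphere (0 : Fin m → ℂ) 1), c ≠ 0 ∧ v = (c : ℂ) • (u : Fin m → ℂ) := by
  have hn : ‖v‖ ≠ 0 := norm_ne_zero_iff.mpr hv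
  have hc : ((‖v‖ : ℝ) : ℂ) ≠ 0 := by exact_mod_cast hn
  refine ⟨‖v‖, ⟨((‖v‖ : ℝ) : ℂ)⁻¹ • v, ?_⟩, hn, ?_⟩
  · rw [mem_sphere_zero_iff_norm, norm_smul, norm_inv, Complex.norm_real, norm_norm,
      inv_mul_cancel₀ hn]
  · rw [smul_smul, mul_inv_cancel₀ hc, one_smul]

theorem sphere_ne_zero (u : Metric.sphere (0 : Fin m → ℂ) 1) : (u : Fin m → ℂ) ≠ 0 :=
  ne_zero_of_mem_unit_sphere u

/-- By homogeneity a sphere (here for the sup norm) suffices as a test set; its compactness gives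
the uniform bounds below. -/
theorem posDef_iff_quad_sphere {X : Matrix (Fin m) (Fin m) ℂ} (hX : X.IsHermitian) :
    X.PosDef ↔ ∀ u : Metric.sphere (0 : Fin m → ℂ) 1, 0 < quad X u := by
  refine ⟨fun h u => h.re_dotProduct_pos (sphere_ne_zero u), fun h => ?_⟩
  refine posDef_of_forall_re hX fun v hv => ?_
  obtain ⟨c, u, hc, rfl⟩ := exists_sphere_smul hv
  have := quad_smul_vec X c u
  rw [quad] at this
  rw [this]
  exact mul_pos (by positivity) (h u)

theorem posSemidef_of_quad_sphere {X : Matrix (Fin m) (Fin m) ℂ} (hX : X.IsHermitian)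
    (h : ∀ u : Metric.sphere (0 : Fin m → ℂ) 1, 0 ≤ quad X u) : X.PosSemidef := by
  refine posSemidef_of_forall_re hX fun v => ?_
  rcases eq_or_ne v 0 with rfl | hv
  · simp
  obtain ⟨c, u, hc, rfl⟩ := exists_sphere_smul hv
  have := quad_smul_vec X c u
  rw [quad] at this
  rw [this]
  exact mul_nonneg (by positivity) (h u)

theorem continuous_quad {X : Type*} [TopologicalSpace X] {F : X → Matrix (Fin m) (Fin m) ℂ}
    {v : X → Fin m → ℂ} (hF : Continuous F) (hv : Continuous v) :
    Continuous fun x => quad (F x) (v x) :=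
  Complex.continuous_re.comp (hv.star.dotProduct (hF.matrix_mulVec hv))

/-- The complement is the projection of a closed set along a compact factor. -/
theorem isOpen_forall_pos {X K : Type*} [TopologicalSpace X] [TopologicalSpace K] [CompactSpace K]
    {f : X × K → ℝ} (hf : Continuous f) : IsOpen {x | ∀ k, 0 < f (x, k)} := by
  have h : {x | ∀ k, 0 < f (x, k)} = (Prod.fst '' {p | f p ≤ 0})ᶜ := by
    ext x; simp
  rw [h, isOpen_compl_iff]
  exact isClosedMap_fst_of_compactSpace _ (isClosed_le hf continuous_const)

/-- `κ` bounds the quotient of the two quadratic forms, which is continuous on the compact product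
of circle and sphere. -/
theorem exists_smul_sub_posSemidef {X Y : Circle → Matrix (Fin m) (Fin m) ℂ}
    (hX : Continuous X) (hXp : ∀ z, (X z).PosDef) (hY : Continuous Y)
    (hYh : ∀ z, (Y z).IsHermitian) :
    ∃ κ : ℝ, ∀ z, ((κ : ℂ) • X z - Y z).PosSemidef := by
  let f : Circle × Metric.sphere (0 : Fin m → ℂ) 1 → ℝ := fun p =>
    quad (Y p.1) p.2 / quad (X p.1) p.2
  have hpos : ∀ z (u : Metric.sphere (0 : Fin m → ℂ) 1), 0 < quad (X z) u := fun z =>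
    (posDef_iff_quad_sphere (hXp z).1).mp (hXp z)
  have hf : Continuous f := by
    have hu : Continuous fun p : Circle × Metric.sphere (0 : Fin m → ℂ) 1 => (p.2 : Fin m → ℂ) :=
      continuous_subtype_val.comp continuous_snd
    exact (continuous_quad (hY.comp continuous_fst) hu).div
      (continuous_quad (hX.comp continuous_fst) hu) fun p => (hpos _ _).ne'
  obtain ⟨κ, hκ⟩ := (isCompact_range hf).bddAbove
  refine ⟨κ, fun z => posSemidef_of_quad_sphere ?_ fun u => ?_⟩
  · refine IsHermitian.sub ?_ (hYh z)
    rw [IsHermitian, conjTranspose_smul, (hXp z).1.eq]; simp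
  · have := hκ ⟨(z, u), rfl⟩
    rw [quad_sub, quad_smul]
    have h2 := (div_le_iff₀ (hpos z u)).mp this
    linarith

theorem isClosed_posSemidef : IsClosed {X : Matrix (Fin m) (Fin m) ℂ | X.PosSemidef} := by
  have h : {X : Matrix (Fin m) (Fin m) ℂ | X.PosSemidef}
      = {X | Xᴴ = X} ∩ ⋂ v : Fin m → ℂ, {X | 0 ≤ quad X v} := by
    ext X
    simp only [Set.mem_inter_iff, Set.mem_iInter, Set.mem_ofPred_eq]
    exact ⟨fun h => ⟨h.1, fun v => h.re_dotProduct_nonneg v⟩,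
      fun h => posSemidef_of_forall_re h.1 h.2⟩
  rw [h]
  exact (isClosed_eq (continuous_id.matrix_conjTranspose) continuous_id).inter
    (isClosed_iInter fun v => isClosed_le continuous_const
      (continuous_quad continuous_id continuous_const))

theorem continuous_logDet {X : Circle → Matrix (Fin m) (Fin m) ℂ}
    (hX : Continuous X) (hXp : ∀ z, (X z).PosDef) : Continuous fun z => logDet (X z) :=
  (Complex.continuous_re.comp hX.matrix_det).log fun z => (posDef_det_re_pos (hXp z)).ne'

theorem continuous_inv_of_posDef {X : Circle → Matrix (Fin m) (Fin m) ℂ}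
    (hX : Continuous X) (hXp : ∀ z, (X z).PosDef) : Continuous fun z => (X z)⁻¹ :=
  continuous_inv_of_isUnit hX fun z => isUnit_det_of_posDef (hXp z)

/-- The integrated first order inequality for the concave functional `∫ log det`. -/
theorem integral_logDet_le {X Y : Circle → Matrix (Fin m) (Fin m) ℂ}
    (hX : Continuous X) (hXp : ∀ z, (X z).PosDef) (hY : EssBdd Y)
    (hYp : ∀ᵐ z ∂circleMeasure, (Y z).PosDef)
    (hYl : Integrable (fun z => logDet (Y z)) circleMeasure) :
    ∫ z, logDet (Y z) ∂circleMeasure ≤ ∫ z, logDet (X z) ∂circleMeasure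
        + ∫ z, ((X z)⁻¹ * (Y z - X z)).trace.re ∂circleMeasure ∧
    (∫ z, logDet (Y z) ∂circleMeasure = ∫ z, logDet (X z) ∂circleMeasure
        + ∫ z, ((X z)⁻¹ * (Y z - X z)).trace.re ∂circleMeasure → Y =ᵐ[circleMeasure] X) := by
  have hXl := integrable_of_continuous (continuous_logDet hX hXp)
  have ht : Integrable (fun z => ((X z)⁻¹ * (Y z - X z)).trace.re) circleMeasure :=
    ((EssBdd.of_continuous (continuous_inv_of_posDef hX hXp)).mul
      (hY.sub (.of_continuous hX))).integrable_trace_re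
  have hle : (fun z => logDet (Y z)) ≤ᵐ[circleMeasure]
      fun z => logDet (X z) + ((X z)⁻¹ * (Y z - X z)).trace.re := by
    filter_upwards [hYp] with z hz using logDet_le_add_trace (hXp z) hz
  rw [← integral_add hXl ht]
  refine ⟨integral_mono_ae hYl (hXl.add ht) hle, fun h => ?_⟩
  have heq := (integral_eq_iff_of_ae_le hYl (hXl.add ht) hle).mp h
  filter_upwards [heq, hYp] with z h1 h2 using eq_of_logDet_eq_add_trace (hXp z) h2 h1

end Compactness

/-! ### Rational, continuous and bounded coercive densities. -/

section RationalDensity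

variable {m : ℕ} {Ψ : Circle → Matrix (Fin m) (Fin m) ℂ}

theorem IsRational.continuous (h : IsRational Ψ) : Continuous Ψ := by
  obtain ⟨P, q, h⟩ := h
  refine continuous_matrix fun i j => ?_
  simp only [fun z => (h z).2 i j]
  have hcoe : Continuous fun z : Circle => (z : ℂ) := by fun_prop
  exact ((P i j).continuous.comp hcoe).div (q.continuous.comp hcoe) fun z => (h z).1

/-- Beyond continuity, this is all that rationality contributes: it excludes a dual optimum on the
boundary. -/
theorem IsRational.differentiableAt (h : IsRational Ψ) (θ : ℝ) (i j : Fin m) :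
    DifferentiableAt ℝ (fun t : ℝ => Ψ (Circle.exp t) i j) θ := by
  obtain ⟨P, q, h⟩ := h
  simp only [fun z => (h z).2 i j]
  have hcoe : DifferentiableAt ℝ (fun t : ℝ => ((Circle.exp t : Circle) : ℂ)) θ := by
    simp only [Circle.coe_exp]
    fun_prop
  have hp : ∀ p : Polynomial ℂ,
      DifferentiableAt ℝ (fun t : ℝ => p.eval ((Circle.exp t : Circle) : ℂ)) θ := fun p =>
    (p.differentiableAt.restrictScalars ℝ).comp θ hcoe
  exact (hp _).div (hp _) (h _).1

theorem IsBddCoerciveDensity.ae_posDef {Φ : Circle → Matrix (Fin m) (Fin m) ℂ}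
    (h : IsBddCoerciveDensity Φ) : ∀ᵐ z ∂circleMeasure, (Φ z).PosDef := by
  obtain ⟨α, hα, h⟩ := h.coercive
  filter_upwards [h] with z hz
  have h1 : ((α : ℂ) • (1 : Matrix (Fin m) (Fin m) ℂ)).PosDef :=
    PosDef.one.smul (by exact_mod_cast hα)
  simpa using hz.add h1

/-- The strict inequality is not a closed condition, so `Ψ ≥ αI` is extended to all points and
strictness is recovered from `α > 0`. -/
theorem IsBddCoerciveDensity.posDef_of_continuous (h : IsBddCoerciveDensity Ψ)
    (hc : Continuous Ψ) (z : Circle) : (Ψ z).PosDef := by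
  obtain ⟨α, hα, h⟩ := h.coercive
  have h1 : ((α : ℂ) • (1 : Matrix (Fin m) (Fin m) ℂ)).PosDef :=
    PosDef.one.smul (by exact_mod_cast hα)
  have h2 := forall_of_ae_of_isClosed
    (p := fun z => (Ψ z - (α : ℂ) • (1 : Matrix (Fin m) (Fin m) ℂ)).PosSemidef)
    (isClosed_posSemidef.preimage (hc.sub continuous_const))
    (h.mono fun z hz => hz.posSemidef) z
  simpa using PosDef.posSemidef_add h2 h1

theorem IsBddCoerciveDensity.conjSymm_of_continuous (h : IsBddCoerciveDensity Ψ)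
    (hc : Continuous Ψ) : ConjSymm Ψ := fun z => by
  rw [(h.posDef_of_continuous hc z).1.eq]
  exact forall_of_ae_of_isClosed (p := fun z => Ψ z⁻¹ = (Ψ z)ᵀ)
    (isClosed_eq (hc.comp continuous_inv) hc.matrix_transpose) h.real z

theorem isBddCoerciveDensity_of_continuous {Φ : Circle → Matrix (Fin m) (Fin m) ℂ}
    (hc : Continuous Φ) (hp : ∀ z, (Φ z).PosDef) (hs : ConjSymm Φ) : IsBddCoerciveDensity Φ where
  aemeasurable i j := (hc.matrix_elem i j).measurable.aemeasurable
  real := .of_forall fun z => by rw [hs z, (hp z).1.eq]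
  bounded := by
    obtain ⟨β, h⟩ := exists_smul_sub_posSemidef (X := fun _ => 1) continuous_const
      (fun _ => PosDef.one) hc fun z => (hp z).1
    exact ⟨β, .of_forall h⟩
  coercive := by
    obtain ⟨κ, h⟩ := exists_smul_sub_posSemidef hc hp (Y := fun _ => 1) continuous_const
      fun _ => isHermitian_one
    -- From `I ≤ κΦ` the strict bound `I < (|κ| + 1)Φ` follows, since `|κ| + 1 > κ`; its reciprocal
    -- is the coercivity constant.
    have hκ : 0 < |κ| + 1 := by positivity
    refine ⟨(|κ| + 1)⁻¹, by positivity, .of_forall fun z => ?_⟩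
    have h2 : (((|κ| + 1 : ℝ) : ℂ) • Φ z - 1).PosDef := by
      have h3 : (((|κ| + 1 - κ : ℝ) : ℂ) • Φ z).PosDef := (hp z).smul (by
        have := le_abs_self κ
        exact_mod_cast (by linarith : (0 : ℝ) < |κ| + 1 - κ))
      have := PosDef.posSemidef_add (h z) h3
      convert this using 1
      rw [Complex.ofReal_sub, sub_smul]; abel
    have h4 := h2.smul (show (0 : ℂ) < (((|κ| + 1)⁻¹ : ℝ) : ℂ) by
      exact_mod_cast (by positivity : (0 : ℝ) < (|κ| + 1)⁻¹))
    convert h4 using 1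
    rw [smul_sub, smul_smul, ← Complex.ofReal_mul, inv_mul_cancel₀ hκ.ne', Complex.ofReal_one,
      one_smul]

/-- In a factorization `C^* C` an entry is an inner product of columns, bounded by half the sum of
their squared norms. This converts the order bound on a density into entrywise bounds. -/
theorem posSemidef_norm_apply_le {X : Matrix (Fin m) (Fin m) ℂ} (hX : X.PosSemidef)
    (i j : Fin m) : ‖X i j‖ ≤ X.trace.re := by
  obtain ⟨C, rfl⟩ := posSemidef_exists_factor hX
  have htr : (Cᴴ * C).trace.re = ∑ k, ∑ l, ‖C l k‖ ^ 2 := by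
    simp only [Matrix.trace, diag_apply, Matrix.mul_apply, conjTranspose_apply, Complex.re_sum]
    refine Finset.sum_congr rfl fun k _ => Finset.sum_congr rfl fun l _ => ?_
    rw [RCLike.star_def, ← Complex.normSq_eq_conj_mul_self, Complex.ofReal_re,
      Complex.normSq_eq_norm_sq]
  have hk : ∀ k, ∑ l, ‖C l k‖ ^ 2 ≤ (Cᴴ * C).trace.re := fun k => by
    rw [htr]
    exact Finset.single_le_sum (f := fun k => ∑ l, ‖C l k‖ ^ 2)
      (fun k _ => Finset.sum_nonneg fun l _ => by positivity) (Finset.mem_univ k)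
  calc ‖(Cᴴ * C) i j‖ ≤ ∑ l, ‖C l i‖ * ‖C l j‖ := by
        rw [Matrix.mul_apply]
        refine (norm_sum_le _ _).trans (Finset.sum_le_sum fun l _ => ?_)
        rw [norm_mul, conjTranspose_apply, norm_star]
    _ ≤ ∑ l, (‖C l i‖ ^ 2 + ‖C l j‖ ^ 2) / 2 := Finset.sum_le_sum fun l _ => by
        nlinarith [sq_nonneg (‖C l i‖ - ‖C l j‖)]
    _ = (∑ l, ‖C l i‖ ^ 2 + ∑ l, ‖C l j‖ ^ 2) / 2 := by
        rw [← Finset.sum_add_distrib, Finset.sum_div]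
    _ ≤ _ := by linarith [hk i, hk j]

theorem IsBddCoerciveDensity.essBdd {Φ : Circle → Matrix (Fin m) (Fin m) ℂ}
    (h : IsBddCoerciveDensity Φ) : EssBdd Φ := fun i j => by
  obtain ⟨β, hβ⟩ := h.bounded
  refine memLp_top_of_bound (h.aemeasurable i j).aestronglyMeasurable (β * m) ?_
  filter_upwards [hβ, h.ae_posDef] with z h1 h2
  refine (posSemidef_norm_apply_le h2.posSemidef i j).trans ?_
  have h3 := (Complex.nonneg_iff.mp h1.trace_nonneg).1
  simp only [trace_sub, trace_smul, trace_one, Complex.sub_re, smul_eq_mul, Fintype.card_fin,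
    Complex.re_ofReal_mul, Complex.natCast_re] at h3
  linarith

/-- Boundedness controls `log det Φ` from above by `tr Φ - m`, coercivity from below by `log det
(αI)`. -/
theorem IsBddCoerciveDensity.integrable_logDet {Φ : Circle → Matrix (Fin m) (Fin m) ℂ}
    (h : IsBddCoerciveDensity Φ) : Integrable (fun z => logDet (Φ z)) circleMeasure := by
  have hmeas : AEStronglyMeasurable (fun z => logDet (Φ z)) circleMeasure := by
    have hd : AEMeasurable (fun z => (Φ z).det) circleMeasure := by
      simp only [Matrix.det_apply']
      exact Finset.aemeasurable_fun_sum _ fun σ _ =>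
        (Finset.aemeasurable_fun_prod _ fun k _ => h.aemeasurable _ _).const_mul _
    exact (Complex.measurable_re.comp_aemeasurable hd).log.aestronglyMeasurable
  obtain ⟨α, hα, hαΦ⟩ := h.coercive
  have hα1 : ((α : ℂ) • (1 : Matrix (Fin m) (Fin m) ℂ)).PosDef :=
    PosDef.one.smul (by exact_mod_cast hα)
  have htr : Integrable (fun z => (Φ z).trace.re - m) circleMeasure :=
    h.essBdd.integrable_trace_re.sub (integrable_const _)
  have hconst : Integrable (fun _ : Circle => logDet ((α : ℂ) • (1 : Matrix (Fin m) (Fin m) ℂ)))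
    circleMeasure := integrable_const _
  refine (htr.norm.add hconst.norm).mono' hmeas ?_
  filter_upwards [hαΦ, h.ae_posDef] with z h1 h2
  have h3 := logDet_le_trace_sub h2
  have h4 := logDet_mono hα1 h2 h1.posSemidef
  simp only [Pi.add_apply, Real.norm_eq_abs]
  rw [abs_le]
  constructor
  · have := neg_abs_le (logDet ((α : ℂ) • (1 : Matrix (Fin m) (Fin m) ℂ)))
    have := abs_nonneg ((Φ z).trace.re - m)
    linarith
  · have := le_abs_self ((Φ z).trace.re - m)
    have := abs_nonneg (logDet ((α : ℂ) • (1 : Matrix (Fin m) (Fin m) ℂ)))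
    linarith

end RationalDensity

/-! ### The dual functional, its tangents and its domain. -/

section Dual

variable {n m : ℕ} {A : Matrix (Fin n) (Fin n) ℝ} {B : Matrix (Fin n) (Fin m) ℝ}
  {S : Matrix (Fin n) (Fin n) ℝ} {Ψ W : Circle → Matrix (Fin m) (Fin m) ℂ}

/-- `Ψ⁻¹ + G^* Λ G`. -/
def dualF (A : Matrix (Fin n) (Fin n) ℝ) (B : Matrix (Fin n) (Fin m) ℝ)
    (Ψ : Circle → Matrix (Fin m) (Fin m) ℂ) (Λ : Matrix (Fin n) (Fin n) ℝ) (z : Circle) :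
    Matrix (Fin m) (Fin m) ℂ :=
  (Ψ z)⁻¹ + hG A B Λ z

theorem PhiOpt_eq_inv (Λ : Matrix (Fin n) (Fin n) ℝ) (z : Circle) :
    PhiOpt A B Ψ Λ z = (dualF A B Ψ Λ z)⁻¹ := rfl

theorem continuous_dualF (hA : IsStable A) (hΨ : Continuous Ψ) (hΨp : ∀ z, (Ψ z).PosDef)
    (Λ : Matrix (Fin n) (Fin n) ℝ) : Continuous (dualF A B Ψ Λ) :=
  (continuous_inv_of_posDef hΨ hΨp).add (continuous_hG hA Λ)

theorem isHermitian_dualF (hΨp : ∀ z, (Ψ z).PosDef) {Λ : Matrix (Fin n) (Fin n) ℝ}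
    (hΛ : Λ.IsSymm) (z : Circle) : (dualF A B Ψ Λ z).IsHermitian :=
  (hΨp z).inv.1.add (isHermitian_hG hΛ z)

theorem conjSymm_dualF (hΨs : ConjSymm Ψ) (Λ : Matrix (Fin n) (Fin n) ℝ) :
    ConjSymm (dualF A B Ψ Λ) :=
  hΨs.inv.add (conjSymm_hG Λ)

theorem dualF_sub_dualF (Λ Λ' : Matrix (Fin n) (Fin n) ℝ) (z : Circle) :
    dualF A B Ψ Λ' z - dualF A B Ψ Λ z = hG A B (Λ' - Λ) z := by
  rw [dualF, dualF, hG_sub]; abel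

theorem dualF_zero (z : Circle) : dualF A B Ψ (0 : Matrix (Fin n) (Fin n) ℝ) z = (Ψ z)⁻¹ := by
  simp [dualF, hG, toC_zero]

theorem dualF_convex (a b : ℝ) (hab : a + b = 1) (Λ Λ' : Matrix (Fin n) (Fin n) ℝ) (z : Circle) :
    dualF A B Ψ (a • Λ + b • Λ') z
      = (a : ℂ) • dualF A B Ψ Λ z + (b : ℂ) • dualF A B Ψ Λ' z := by
  have h : (Ψ z)⁻¹ = (a : ℂ) • (Ψ z)⁻¹ + (b : ℂ) • (Ψ z)⁻¹ := by
    rw [← add_smul, ← Complex.ofReal_add, hab, Complex.ofReal_one, one_smul]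
  simp only [dualF, hG_add, hG_smul, smul_add]
  nth_rewrite 1 [h]
  abel

/-- The domain on which `Ψ⁻¹ + G^* Λ G` is positive definite on the circle. -/
def DualDom (A : Matrix (Fin n) (Fin n) ℝ) (B : Matrix (Fin n) (Fin m) ℝ)
    (Ψ : Circle → Matrix (Fin m) (Fin m) ℂ) (Λ : Matrix (Fin n) (Fin n) ℝ) : Prop :=
  ∀ z, (dualF A B Ψ Λ z).PosDef

theorem dualDom_zero (hΨp : ∀ z, (Ψ z).PosDef) :
    DualDom A B Ψ (0 : Matrix (Fin n) (Fin n) ℝ) := fun z => by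
  rw [dualF_zero]; exact (hΨp z).inv

/-- One end point may lie on the boundary, provided the interior one has positive weight. -/
theorem dualDom_convex {Λ Λ' : Matrix (Fin n) (Fin n) ℝ}
    (hΛ : ∀ z, (dualF A B Ψ Λ z).PosSemidef) (hΛ' : DualDom A B Ψ Λ') {a b : ℝ}
    (hab : a + b = 1) (ha : 0 ≤ a) (hb : 0 < b) : DualDom A B Ψ (a • Λ + b • Λ') := fun z => by
  rw [dualF_convex a b hab]
  exact PosDef.posSemidef_add ((hΛ z).smul (by exact_mod_cast ha))
    ((hΛ' z).smul (by exact_mod_cast hb))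

theorem continuous_phiOpt (hA : IsStable A) (hΨ : Continuous Ψ) (hΨp : ∀ z, (Ψ z).PosDef)
    {Λ : Matrix (Fin n) (Fin n) ℝ} (hΛ : DualDom A B Ψ Λ) : Continuous (PhiOpt A B Ψ Λ) :=
  continuous_inv_of_posDef (continuous_dualF hA hΨ hΨp Λ) hΛ

theorem isBddCoerciveDensity_phiOpt (hA : IsStable A) (hΨ : Continuous Ψ)
    (hΨp : ∀ z, (Ψ z).PosDef) (hΨs : ConjSymm Ψ)
    {Λ : Matrix (Fin n) (Fin n) ℝ} (hΛ : DualDom A B Ψ Λ) :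
    IsBddCoerciveDensity (PhiOpt A B Ψ Λ) :=
  isBddCoerciveDensity_of_continuous (continuous_phiOpt hA hΨ hΨp hΛ) (fun z => (hΛ z).inv)
    (conjSymm_dualF hΨs Λ).inv

/-! ### The dual functional in terms of `Ψ⁻¹ + G^* Λ G` -/

theorem isUnit_factor (hW : IsSpectralFactor W Ψ) (hΨp : ∀ z, (Ψ z).PosDef)
    (z : Circle) : IsUnit (W z) := by
  have h : IsUnit (W z * (W z)ᴴ) := hW z ▸ (hΨp z).isUnit
  rw [Matrix.isUnit_iff_isUnit_det, det_mul] at h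
  exact (Matrix.isUnit_iff_isUnit_det _).mpr (isUnit_of_mul_isUnit_left h)

theorem factor_congruence_inv (hW : IsSpectralFactor W Ψ) (hΨp : ∀ z, (Ψ z).PosDef)
    (z : Circle) : (W z)ᴴ * (Ψ z)⁻¹ * W z = 1 := by
  have hu := (Matrix.isUnit_iff_isUnit_det _).mp (isUnit_factor hW hΨp z)
  have hu' : IsUnit ((W z)ᴴ).det := by rw [det_conjTranspose]; exact hu.star
  rw [← hW z, Matrix.mul_inv_rev, ← Matrix.mul_assoc, Matrix.mul_nonsing_inv _ hu', Matrix.one_mul,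
    Matrix.nonsing_inv_mul _ hu]

/-- This removes the factor `W`, for which no continuity is assumed: it acts by a pointwise
congruence, affecting neither positivity nor, up to the constant `∫ log det Ψ`, the functional. -/
theorem Q_eq_congruence (hW : IsSpectralFactor W Ψ) (hΨp : ∀ z, (Ψ z).PosDef)
    (Λ : Matrix (Fin n) (Fin n) ℝ) (z : Circle) :
    Q A B W Λ z = (W z)ᴴ * dualF A B Ψ Λ z * W z := by
  rw [dualF, Matrix.mul_add, Matrix.add_mul, factor_congruence_inv hW hΨp, Q, hG]
  simp only [conjTranspose_mul, Matrix.mul_assoc]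

theorem Q_add_eq_congruence (hW : IsSpectralFactor W Ψ) (hΨp : ∀ z, (Ψ z).PosDef)
    (Λ : Matrix (Fin n) (Fin n) ℝ) (c : ℂ) (z : Circle) :
    Q A B W Λ z + c • (1 : Matrix (Fin m) (Fin m) ℂ)
      = (W z)ᴴ * (dualF A B Ψ Λ z + c • (Ψ z)⁻¹) * W z := by
  rw [Matrix.mul_add, Matrix.add_mul, Q_eq_congruence hW hΨp, Matrix.mul_smul, Matrix.smul_mul,
    factor_congruence_inv hW hΨp]

theorem posDef_Q_iff (hW : IsSpectralFactor W Ψ) (hΨp : ∀ z, (Ψ z).PosDef)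
    (Λ : Matrix (Fin n) (Fin n) ℝ) (z : Circle) :
    (Q A B W Λ z).PosDef ↔ (dualF A B Ψ Λ z).PosDef := by
  rw [Q_eq_congruence hW hΨp, ← star_eq_conjTranspose]
  exact IsUnit.posDef_star_left_conjugate_iff (isUnit_factor hW hΨp z)

theorem log_det_congruence (hW : IsSpectralFactor W Ψ) (hΨp : ∀ z, (Ψ z).PosDef)
    {X : Matrix (Fin m) (Fin m) ℂ} (hX : X.PosDef) (z : Circle) :
    Real.log ((W z)ᴴ * X * W z).det.re = logDet (Ψ z) + logDet X := by
  rw [← logDet_mul (hΨp z) hX, ← hW z]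
  congr 2
  simp only [det_mul]; ring

theorem mem_LplusGamma_iff (hW : IsSpectralFactor W Ψ) (hΨp : ∀ z, (Ψ z).PosDef)
    (Λ : rangeGamma A B) : Λ ∈ LplusGamma A B W ↔ DualDom A B Ψ Λ.1 :=
  ⟨fun h z => (posDef_Q_iff hW hΨp _ z).mp (h.2 z),
    fun h => ⟨isSymm_of_mem_rangeGamma Λ.2, fun z => (posDef_Q_iff hW hΨp _ z).mpr (h z)⟩⟩

theorem integral_const_sub_add {c : ℝ} {f g : Circle → ℝ} (hf : Integrable f circleMeasure)
    (hg : Integrable g circleMeasure) :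
    ∫ z, (c - (f z + g z)) ∂circleMeasure
      = c - ∫ z, f z ∂circleMeasure - ∫ z, g z ∂circleMeasure := by
  have h := integral_sub (integrable_const c) (hf.add hg)
  have h' := integral_add hf hg
  simp only [Pi.add_apply] at h
  rw [h, h']
  simp; ring

theorem J_eq (hA : IsStable A) (hW : IsSpectralFactor W Ψ) (hΨ : Continuous Ψ)
    (hΨp : ∀ z, (Ψ z).PosDef) {Λ : Matrix (Fin n) (Fin n) ℝ} (hΛ : DualDom A B Ψ Λ) :
    J A B S W Λ = (Λ * S).trace - ∫ z, logDet (Ψ z) ∂circleMeasure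
      - ∫ z, logDet (dualF A B Ψ Λ z) ∂circleMeasure := by
  have h1 := integrable_of_continuous (continuous_logDet hΨ hΨp)
  have h2 := integrable_of_continuous (continuous_logDet (continuous_dualF hA hΨ hΨp Λ) hΛ)
  simp only [J, Q_eq_congruence hW hΨp, fun z => log_det_congruence hW hΨp (hΛ z) z]
  exact integral_const_sub_add h1 h2

theorem Jreg_eq (hA : IsStable A) (hW : IsSpectralFactor W Ψ) (hΨ : Continuous Ψ)
    (hΨp : ∀ z, (Ψ z).PosDef) {Λ : Matrix (Fin n) (Fin n) ℝ} {ε : ℝ}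
    (hΛ : ∀ z, (dualF A B Ψ Λ z + (ε : ℂ) • (Ψ z)⁻¹).PosDef) :
    Jreg A B S W ε Λ = (Λ * S).trace - ∫ z, logDet (Ψ z) ∂circleMeasure
      - ∫ z, logDet (dualF A B Ψ Λ z + (ε : ℂ) • (Ψ z)⁻¹) ∂circleMeasure := by
  have h1 := integrable_of_continuous (continuous_logDet hΨ hΨp)
  have h2 := integrable_of_continuous (continuous_logDet ((continuous_dualF hA hΨ hΨp Λ).add
    ((continuous_inv_of_posDef hΨ hΨp).const_smul (ε : ℂ))) hΛ)
  simp only [Jreg, Q_add_eq_congruence hW hΨp, fun z => log_det_congruence hW hΨp (hΛ z) z]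
  exact integral_const_sub_add h1 h2

/-- The directional derivative of the dual functional. -/
def gradJ (A : Matrix (Fin n) (Fin n) ℝ) (B : Matrix (Fin n) (Fin m) ℝ)
    (S : Matrix (Fin n) (Fin n) ℝ) (Ψ : Circle → Matrix (Fin m) (Fin m) ℂ)
    (Λ D : Matrix (Fin n) (Fin n) ℝ) : ℝ :=
  (D * S).trace - (toC D * moment A B (PhiOpt A B Ψ Λ)).trace.re

theorem continuous_gradJ (Λ : Matrix (Fin n) (Fin n) ℝ) : Continuous (gradJ A B S Ψ Λ) :=
  (continuous_id.matrix_mul continuous_const).matrix_trace.sub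
    (Complex.continuous_re.comp (continuous_toC.matrix_mul continuous_const).matrix_trace)

theorem gradJ_smul (Λ D : Matrix (Fin n) (Fin n) ℝ) (c : ℝ) :
    gradJ A B S Ψ Λ (c • D) = c * gradJ A B S Ψ Λ D := by
  simp only [gradJ, toC_smul, Matrix.smul_mul, trace_smul, smul_eq_mul, Complex.re_ofReal_mul]
  ring

theorem gradJ_eq (hA : IsStable A) (hΨ : Continuous Ψ) (hΨp : ∀ z, (Ψ z).PosDef)
    {Λ : Matrix (Fin n) (Fin n) ℝ} (hΛ : DualDom A B Ψ Λ) (D : Matrix (Fin n) (Fin n) ℝ) :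
    gradJ A B S Ψ Λ D = (D * S).trace
      - ∫ z, ((dualF A B Ψ Λ z)⁻¹ * hG A B D z).trace.re ∂circleMeasure := by
  rw [gradJ, trace_mul_moment hA (.of_continuous (continuous_phiOpt hA hΨ hΨp hΛ))]
  congr 2; funext z
  rw [Matrix.trace_mul_comm, PhiOpt_eq_inv]

/-- Moment matching is exactly what makes the dual functional stationary. -/
theorem gradJ_eq_zero (hΛ : moment A B (PhiOpt A B Ψ Λ) = toC S)
    (D : Matrix (Fin n) (Fin n) ℝ) : gradJ A B S Ψ Λ D = 0 := by
  rw [gradJ, hΛ, ← toC_mul, toC_trace_re, sub_self]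

/-- The dual functional lies above its tangents. -/
theorem J_add_gradJ_le (hA : IsStable A) (hW : IsSpectralFactor W Ψ) (hΨ : Continuous Ψ)
    (hΨp : ∀ z, (Ψ z).PosDef) {Λ Λ' : Matrix (Fin n) (Fin n) ℝ} (hΛ : DualDom A B Ψ Λ)
    (hΛ' : DualDom A B Ψ Λ') :
    J A B S W Λ + gradJ A B S Ψ Λ (Λ' - Λ) ≤ J A B S W Λ' ∧
    (Λ ∈ rangeGamma A B → Λ' ∈ rangeGamma A B →
      J A B S W Λ + gradJ A B S Ψ Λ (Λ' - Λ) = J A B S W Λ' → Λ' = Λ) := by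
  have hc := continuous_dualF (B := B) hA hΨ hΨp Λ
  have hc' := continuous_dualF (B := B) hA hΨ hΨp Λ'
  obtain ⟨h1, h2⟩ := integral_logDet_le hc hΛ (.of_continuous hc') (.of_forall hΛ')
    (integrable_of_continuous (continuous_logDet hc' hΛ'))
  simp only [dualF_sub_dualF] at h1 h2
  rw [J_eq hA hW hΨ hΨp hΛ, J_eq hA hW hΨ hΨp hΛ', gradJ_eq hA hΨ hΨp hΛ, Matrix.sub_mul, trace_sub]
  refine ⟨by linarith, fun hm hm' h => ?_⟩
  -- Equality makes the two functions agree a.e., hence everywhere by continuity, so `G^* (Λ' - Λ) G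
  -- = 0`.
  have h3 := h2 (by linarith)
  have h4 := (hc'.ae_eq_iff_eq circleMeasure hc).mp h3
  refine sub_eq_zero.mp (eq_zero_of_hG_eq_zero hA ((rangeSub hA B).sub_mem hm' hm)
    fun z => ?_)
  rw [← dualF_sub_dualF (Ψ := Ψ), h4, sub_self]

/-- The regularized functional lies above the perturbed tangents of the dual functional. -/
theorem J_add_gradJ_le_Jreg (hA : IsStable A) (hW : IsSpectralFactor W Ψ) (hΨ : Continuous Ψ)
    (hΨp : ∀ z, (Ψ z).PosDef) {Λ Λ' : Matrix (Fin n) (Fin n) ℝ} (hΛ : DualDom A B Ψ Λ)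
    (hΛ' : ∀ z, (dualF A B Ψ Λ' z).PosSemidef) {ε : ℝ} (hε : 0 < ε) :
    J A B S W Λ + gradJ A B S Ψ Λ (Λ' - Λ)
      - ε * ∫ z, ((dualF A B Ψ Λ z)⁻¹ * (Ψ z)⁻¹).trace.re ∂circleMeasure
      ≤ Jreg A B S W ε Λ' := by
  have hc := continuous_dualF (B := B) hA hΨ hΨp Λ
  have hi := continuous_inv_of_posDef hΨ hΨp
  have hc' := (continuous_dualF (B := B) hA hΨ hΨp Λ').add (hi.const_smul (ε : ℂ))
  have hp : ∀ z, (dualF A B Ψ Λ' z + (ε : ℂ) • (Ψ z)⁻¹).PosDef := fun z =>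
    PosDef.posSemidef_add (hΛ' z) ((hΨp z).inv.smul (by exact_mod_cast hε))
  have h1 := (integral_logDet_le (Y := fun z => dualF A B Ψ Λ' z + (ε : ℂ) • (Ψ z)⁻¹)
    hc hΛ (.of_continuous hc') (.of_forall hp)
    (integrable_of_continuous (continuous_logDet hc' hp))).1
  have e : ∀ z, ((dualF A B Ψ Λ z)⁻¹ *
      (dualF A B Ψ Λ' z + (ε : ℂ) • (Ψ z)⁻¹ - dualF A B Ψ Λ z)).trace.re
      = ((dualF A B Ψ Λ z)⁻¹ * hG A B (Λ' - Λ) z).trace.re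
        + ε * ((dualF A B Ψ Λ z)⁻¹ * (Ψ z)⁻¹).trace.re := by
    intro z
    rw [add_sub_right_comm, dualF_sub_dualF, Matrix.mul_add, trace_add, Complex.add_re,
      Matrix.mul_smul, trace_smul, smul_eq_mul, Complex.re_ofReal_mul]
  have hci := continuous_inv_of_posDef hc hΛ
  simp only [e] at h1
  rw [integral_add, integral_const_mul] at h1
  · rw [J_eq hA hW hΨ hΨp hΛ, Jreg_eq hA hW hΨ hΨp hp, gradJ_eq hA hΨ hΨp hΛ, Matrix.sub_mul,
      trace_sub]
    linarith
  · exact (EssBdd.of_continuous (hci.matrix_mul (continuous_hG hA _))).integrable_trace_re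
  · exact (EssBdd.of_continuous (hci.matrix_mul hi)).integrable_trace_re.const_mul _

/-! ### Openness and unboundedness of the domain -/

theorem isOpen_LplusGamma (hA : IsStable A) (hW : IsSpectralFactor W Ψ) (hΨ : Continuous Ψ)
    (hΨp : ∀ z, (Ψ z).PosDef) : IsOpen (LplusGamma A B W) := by
  let f : rangeGamma A B × (Circle × Metric.sphere (0 : Fin m → ℂ) 1) → ℝ := fun p =>
    quad (dualF A B Ψ p.1 p.2.1) p.2.2
  have hG' : Continuous fun p : rangeGamma A B × (Circle × Metric.sphere (0 : Fin m → ℂ) 1) =>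
      G A B p.2.1 := (continuous_G hA).comp (continuous_fst.comp continuous_snd)
  have hf : Continuous f := by
    refine continuous_quad (Continuous.add ?_ ?_)
      (continuous_subtype_val.comp (continuous_snd.comp continuous_snd))
    · exact (continuous_inv_of_posDef hΨ hΨp).comp (continuous_fst.comp continuous_snd)
    · exact (hG'.matrix_conjTranspose.matrix_mul
        (continuous_toC.comp (continuous_subtype_val.comp continuous_fst))).matrix_mul hG'
  convert isOpen_forall_pos hf using 1
  ext Λ
  rw [mem_LplusGamma_iff hW hΨp]
  have := fun z => posDef_iff_quad_sphere
    (isHermitian_dualF (A := A) (B := B) hΨp (isSymm_of_mem_rangeGamma Λ.2) z)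
  exact ⟨fun h k => (this k.1).mp (h k.1) k.2, fun h z => (this z).mpr fun u => h (z, u)⟩

theorem closure_LplusGamma_subset (hW : IsSpectralFactor W Ψ)
    (hΨp : ∀ z, (Ψ z).PosDef) {Λ : rangeGamma A B}
    (hΛ : Λ ∈ closure (LplusGamma A B W)) (z : Circle) : (dualF A B Ψ Λ z).PosSemidef := by
  have hcl : IsClosed {Λ : rangeGamma A B | (dualF A B Ψ Λ.1 z).PosSemidef} := by
    refine isClosed_posSemidef.preimage (f := fun Λ : rangeGamma A B => dualF A B Ψ Λ.1 z) ?_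
    exact continuous_const.add ((continuous_const.matrix_mul
        (continuous_toC.comp continuous_subtype_val)).matrix_mul continuous_const)
  exact closure_minimal
    (fun Λ h => ((mem_LplusGamma_iff hW hΨp Λ).mp h z).posSemidef) hcl hΛ

/-- The domain contains the ray through `M = Γ(I) = ∫ G G^* ≥ 0`, as `G^* M G ≥ 0`. This `M` is
nonzero: otherwise `G` would vanish on the circle, hence `B = 0`, against rank `m > 0`. -/
theorem unbounded_LplusGamma (hm : 0 < m) (hA : IsStable A) (hB : B.rank = m)
    (hW : IsSpectralFactor W Ψ) (hΨp : ∀ z, (Ψ z).PosDef) :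
    ¬ ∃ C : ℝ, ∀ Λ ∈ LplusGamma A B W, ∀ i j, |Λ.1 i j| ≤ C := by
  rintro ⟨C, hC⟩
  obtain ⟨-, M, hM, hMI⟩ := exists_mem_rangeGamma (A := A) (B := B) (m := m)
    (Φ := fun _ => 1) continuous_const ConjSymm.one fun _ => PosSemidef.one
  have hE : EssBdd fun _ : Circle => (1 : Matrix (Fin m) (Fin m) ℂ) :=
    .of_continuous continuous_const
  have hGp : ∀ z, (G A B z * (G A B z)ᴴ).PosSemidef := fun z =>
    posSemidef_self_mul_conjTranspose _
  have hMtr : ∀ N : Matrix (Fin n) (Fin n) ℂ, (N * toC M).trace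
      = ∫ z, (N * (G A B z * (1 : Matrix (Fin m) (Fin m) ℂ) * (G A B z)ᴴ)).trace ∂circleMeasure := fun N => by
    have h1 : EssBdd fun z => G A B z * (1 : Matrix (Fin m) (Fin m) ℂ) * (G A B z)ᴴ :=
      ((EssBdd.of_continuous (continuous_G hA)).mul hE).mul
        (.of_continuous (continuous_G hA).matrix_conjTranspose)
    rw [hMI, moment, h1.trace_mul_integral]
  have hMp : (toC M).PosSemidef := by
    refine posSemidef_of_forall_re ?_ fun v => ?_
    · rw [IsHermitian, ← toC_transpose, (isSymm_of_mem_rangeGamma hM).eq]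
    · have h2 : star v ⬝ᵥ (toC M *ᵥ v) = (vecMulVec v (star v) * toC M).trace := by
        rw [vecMulVec_mul, trace_vecMulVec, dotProduct_comm v, ← dotProduct_mulVec]
      have h3 : Integrable (fun z => (vecMulVec v (star v) *
          (G A B z * (1 : Matrix (Fin m) (Fin m) ℂ) * (G A B z)ᴴ)).trace) circleMeasure :=
        (EssBdd.of_continuous (continuous_const.matrix_mul (((continuous_G hA).matrix_mul
          continuous_const).matrix_mul (continuous_G hA).matrix_conjTranspose))).integrable_trace
      rw [h2, hMtr]
      have h4 := integral_re h3
      simp only [RCLike.re_to_complex] at h4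
      rw [← h4]
      refine integral_nonneg fun z => ?_
      rw [Matrix.mul_one]
      exact trace_mul_nonneg (posSemidef_vecMulVec_self_star v) (hGp z)
  have hM0 : M ≠ 0 := by
    rintro rfl
    have h1 : ∀ z, hG A B (1 : Matrix (Fin n) (Fin n) ℝ) z = (G A B z)ᴴ * G A B z := fun z => by
      rw [hG, toC_one, Matrix.mul_one]
    have h2 := trace_mul_eq_integral hA hE hMI.symm (1 : Matrix (Fin n) (Fin n) ℝ)
    simp only [h1, Matrix.mul_one, trace_zero, Matrix.mul_zero] at h2
    have hc : Continuous fun z => ((G A B z)ᴴ * G A B z).trace.re := Complex.continuous_re.comp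
      ((continuous_G hA).matrix_conjTranspose.matrix_mul (continuous_G hA)).matrix_trace
    have hnn : ∀ z, 0 ≤ ((G A B z)ᴴ * G A B z).trace.re := fun z =>
      (Complex.nonneg_iff.mp (posSemidef_conjTranspose_mul_self (G A B z)).trace_nonneg).1
    have h3 := eq_zero_of_integral_nonneg hc hnn h2.ge 1
    have h4 : ((G A B 1)ᴴ * G A B 1).trace = 0 :=
      Complex.ext h3 (Complex.nonneg_iff.mp
        (posSemidef_conjTranspose_mul_self (G A B 1)).trace_nonneg).2.symm
    have h5 : G A B 1 = 0 := trace_conjTranspose_mul_self_eq_zero_iff.mp h4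
    have h6 : toC B = 0 := by
      have := Matrix.mul_nonsing_inv_cancel_left _ (toC B) (hA.isUnit_det_circle 1)
      rw [← this]
      change _ * G A B 1 = 0
      rw [h5, Matrix.mul_zero]
    have h7 : B = 0 := toC_injective (h6.trans toC_zero.symm)
    rw [h7, rank_zero] at hB
    omega
  obtain ⟨i, j, hij⟩ : ∃ i j, M i j ≠ 0 := by
    by_contra! h
    exact hM0 (Matrix.ext h)
  have hmem : ∀ c : ℝ, 0 ≤ c → ∃ Λ ∈ LplusGamma A B W, Λ.1 = c • M := by
    intro c hc
    refine ⟨⟨c • M, (rangeSub hA B).smul_mem c hM⟩, (mem_LplusGamma_iff hW hΨp _).mpr fun z => ?_,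
      rfl⟩
    refine (hΨp z).inv.add_posSemidef ?_
    rw [hG_smul]
    exact (hMp.conjTranspose_mul_mul_same (G A B z)).smul (by exact_mod_cast hc)
  -- The factor gives the chosen entry the absolute value `|C| + 1`.
  obtain ⟨Λ, hΛ, hΛM⟩ := hmem ((|C| + 1) / |M i j|) (by positivity)
  have h := hC Λ hΛ i j
  rw [hΛM, Matrix.smul_apply, smul_eq_mul, abs_mul, abs_of_nonneg (by positivity),
    div_mul_cancel₀ _ (abs_pos.mpr hij).ne'] at h
  linarith [le_abs_self C]

end Dual

/-! ### Existence of an interior dual solution. -/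

section Existence

open Filter Topology

variable {n m : ℕ} {A : Matrix (Fin n) (Fin n) ℝ} {B : Matrix (Fin n) (Fin m) ℝ}
  {S : Matrix (Fin n) (Fin n) ℝ} {Ψ W Φ : Circle → Matrix (Fin m) (Fin m) ℂ}

theorem trace_mul_eq_integral_dualF (hA : IsStable A) (hΨ : Continuous Ψ)
    (hΨp : ∀ z, (Ψ z).PosDef) (hΦ : Continuous Φ) (Λ : Matrix (Fin n) (Fin n) ℝ) :
    ∫ z, (hG A B Λ z * Φ z).trace.re ∂circleMeasure
      = ∫ z, (dualF A B Ψ Λ z * Φ z).trace.re ∂circleMeasure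
        - ∫ z, ((Ψ z)⁻¹ * Φ z).trace.re ∂circleMeasure := by
  rw [← integral_sub]
  · congr 1; funext z
    rw [dualF, Matrix.add_mul, trace_add, Complex.add_re, add_sub_cancel_left]
  · exact (EssBdd.of_continuous
      ((continuous_dualF hA hΨ hΨp Λ).matrix_mul hΦ)).integrable_trace_re
  · exact (EssBdd.of_continuous
      ((continuous_inv_of_posDef hΨ hΨp).matrix_mul hΦ)).integrable_trace_re

/-- The dual functional controls a weighted integral of the trace of `Ψ⁻¹ + G^* Λ G`. -/
theorem exists_J_lower_bound (hA : IsStable A) (hW : IsSpectralFactor W Ψ) (hΨ : Continuous Ψ)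
    (hΨp : ∀ z, (Ψ z).PosDef) (hΦ : Continuous Φ) (hΦp : ∀ z, (Φ z).PosDef)
    (hΦS : moment A B Φ = toC S) :
    ∃ C : ℝ, ∀ Λ, DualDom A B Ψ Λ →
      1 / 2 * ∫ z, (dualF A B Ψ Λ z * Φ z).trace.re ∂circleMeasure - C ≤ J A B S W Λ := by
  -- The tangent to log det at `2Φ⁻¹` has slope `Φ/2`, so half of the term `∫ tr(F_Λ Φ)` coming from
  -- `tr(ΛS)` survives.
  set X : Circle → Matrix (Fin m) (Fin m) ℂ := fun z => (2 : ℂ) • (Φ z)⁻¹ with hX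
  have hXc : Continuous X := (continuous_inv_of_posDef hΦ hΦp).const_smul (2 : ℂ)
  have hXp : ∀ z, (X z).PosDef := fun z => (hΦp z).inv.smul two_pos
  have hXi : ∀ z, (X z)⁻¹ = (2⁻¹ : ℂ) • Φ z := fun z => by
    refine Matrix.inv_eq_left_inv ?_
    rw [hX, Matrix.smul_mul, Matrix.mul_smul, smul_smul,
      Matrix.mul_nonsing_inv _ (isUnit_det_of_posDef (hΦp z))]
    norm_num
  refine ⟨∫ z, ((Ψ z)⁻¹ * Φ z).trace.re ∂circleMeasure + ∫ z, logDet (Ψ z) ∂circleMeasure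
    + ∫ z, logDet (X z) ∂circleMeasure - m, fun Λ hΛ => ?_⟩
  have hc := continuous_dualF (B := B) hA hΨ hΨp Λ
  have h1 := (integral_logDet_le hXc hXp (.of_continuous hc) (.of_forall hΛ)
    (integrable_of_continuous (continuous_logDet hc hΛ))).1
  have h2 : ∀ z, ((X z)⁻¹ * (dualF A B Ψ Λ z - X z)).trace.re
      = 1 / 2 * (dualF A B Ψ Λ z * Φ z).trace.re - m := fun z => by
    rw [trace_inv_mul_sub (hXp z), hXi, Matrix.smul_mul, trace_smul, Matrix.trace_mul_comm,
      smul_eq_mul, show (2⁻¹ : ℂ) = ((1 / 2 : ℝ) : ℂ) by norm_num, Complex.re_ofReal_mul]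
  simp only [h2] at h1
  rw [integral_sub ((EssBdd.of_continuous (hc.matrix_mul hΦ)).integrable_trace_re.const_mul _)
    (integrable_const _), integral_const_mul] at h1
  simp only [integral_const, probReal_univ, one_smul] at h1
  rw [J_eq hA hW hΨ hΨp hΛ, trace_mul_eq_integral hA (.of_continuous hΦ) hΦS,
    trace_mul_eq_integral_dualF hA hΨ hΨp hΦ]
  linarith

/-- On the range of `Γ`, every entry is represented by the trace form. -/
theorem exists_entry_eq_trace (hA : IsStable A) (B : Matrix (Fin n) (Fin m) ℝ) (i j : Fin n) :
    ∃ M ∈ rangeSub hA B, ∀ Λ ∈ rangeSub hA B, Λ i j = (Λ * M).trace := by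
  let V := rangeSub hA B
  let T : V →ₗ[ℝ] Module.Dual ℝ V := LinearMap.mk₂ ℝ (fun M Λ : V => (Λ.1 * M.1).trace)
    (fun _ _ _ => by simp [Matrix.mul_add]) (fun _ _ _ => by simp)
    (fun _ _ _ => by simp [Matrix.add_mul]) (fun _ _ _ => by simp)
  -- The trace form is definite on symmetric matrices, so in finite dimension it represents every
  -- functional, in particular each entry.
  have hinj : Function.Injective T := by
    rw [← LinearMap.ker_eq_bot, LinearMap.ker_eq_bot']
    intro M hM
    have h : (M.1 * M.1).trace = 0 := by
      have := LinearMap.congr_fun hM M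
      simpa [T] using this
    have h2 : (M.1ᴴ * M.1).trace = 0 := by
      rw [conjTranspose_eq_transpose_of_trivial, (isSymm_of_mem_rangeGamma M.2).eq, h]
    exact Subtype.ext (trace_conjTranspose_mul_self_eq_zero_iff.mp h2)
  have hsurj : Function.Surjective T :=
    (LinearMap.injective_iff_surjective_of_finrank_eq_finrank
      (Subspace.dual_finrank_eq (K := ℝ) (V := V)).symm).mp hinj
  obtain ⟨M, hM⟩ := hsurj ((Matrix.entryLinearMap ℝ ℝ i j).comp V.subtype)
  refine ⟨M.1, M.2, fun Λ hΛ => ?_⟩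
  have := LinearMap.congr_fun hM ⟨Λ, hΛ⟩
  simpa [T] using this.symm

/-- Write `M = Γ(Φ')`. For a spectral density `Φ' ≤ κΦ`, positivity of `F_Λ` bounds `∫ tr(F_Λ Φ')`
by `|κ| c`; linearity extends the bound to the span. With the entry representation this bounds
minimizing sequences. -/
theorem exists_trace_bound (hA : IsStable A) (hΨ : Continuous Ψ)
    (hΨp : ∀ z, (Ψ z).PosDef) (hΦ : Continuous Φ) (hΦp : ∀ z, (Φ z).PosDef) (c : ℝ)
    {M : Matrix (Fin n) (Fin n) ℝ} (hM : M ∈ rangeGamma A B) :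
    ∃ C : ℝ, ∀ Λ, DualDom A B Ψ Λ →
      ∫ z, (dualF A B Ψ Λ z * Φ z).trace.re ∂circleMeasure ≤ c → |(Λ * M).trace| ≤ C := by
  obtain ⟨Φ', hΦ', hMΦ⟩ := hM
  simp only [fun Λ => trace_mul_eq_integral hA (.of_continuous (contDensitySpan_prop hΦ').1)
    hMΦ.symm Λ]
  clear hMΦ
  have hint : ∀ {X : Circle → Matrix (Fin m) (Fin m) ℂ} (Λ : Matrix (Fin n) (Fin n) ℝ),
      Continuous X → Integrable (fun z => (hG A B Λ z * X z).trace.re) circleMeasure :=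
    fun Λ hX => (EssBdd.of_continuous ((continuous_hG hA Λ).matrix_mul hX)).integrable_trace_re
  induction hΦ' using Submodule.span_induction with
  | mem X h =>
    obtain ⟨κ, hκ⟩ := exists_smul_sub_posSemidef hΦ hΦp h.continuous fun z => (h.posSemidef z).1
    refine ⟨|κ| * c + |∫ z, ((Ψ z)⁻¹ * X z).trace.re ∂circleMeasure|, fun Λ hΛ hc => ?_⟩
    rw [trace_mul_eq_integral_dualF hA hΨ hΨp h.continuous]
    refine (abs_sub _ _).trans (add_le_add ?_ le_rfl)
    have hFc := continuous_dualF (B := B) hA hΨ hΨp Λ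
    have h0 : 0 ≤ ∫ z, (dualF A B Ψ Λ z * X z).trace.re ∂circleMeasure :=
      integral_nonneg fun z => trace_mul_nonneg (hΛ z).posSemidef (h.posSemidef z)
    have h0' : 0 ≤ ∫ z, (dualF A B Ψ Λ z * Φ z).trace.re ∂circleMeasure :=
      integral_nonneg fun z => trace_mul_nonneg (hΛ z).posSemidef (hΦp z).posSemidef
    have h1 : ∫ z, (dualF A B Ψ Λ z * X z).trace.re ∂circleMeasure
        ≤ κ * ∫ z, (dualF A B Ψ Λ z * Φ z).trace.re ∂circleMeasure := by
      rw [← integral_const_mul]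
      refine integral_mono (EssBdd.of_continuous (hFc.matrix_mul h.continuous)).integrable_trace_re
        ((EssBdd.of_continuous (hFc.matrix_mul hΦ)).integrable_trace_re.const_mul _) fun z => ?_
      have := trace_mul_mono_right (hΛ z).posSemidef (hκ z)
      rwa [Matrix.mul_smul, trace_smul, smul_eq_mul, Complex.re_ofReal_mul] at this
    rw [abs_of_nonneg h0]
    calc _ ≤ _ := h1
      _ ≤ |κ| * ∫ z, (dualF A B Ψ Λ z * Φ z).trace.re ∂circleMeasure :=
        mul_le_mul_of_nonneg_right (le_abs_self κ) h0'
      _ ≤ _ := mul_le_mul_of_nonneg_left hc (abs_nonneg κ)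
  | zero => exact ⟨0, fun Λ _ _ => by simp⟩
  | add X Y hX hY ihX ihY =>
    obtain ⟨C, hC⟩ := ihX
    obtain ⟨C', hC'⟩ := ihY
    refine ⟨C + C', fun Λ hΛ hc => ?_⟩
    simp only [Pi.add_apply, Matrix.mul_add, trace_add, Complex.add_re]
    rw [integral_add (hint Λ (contDensitySpan_prop hX).1) (hint Λ (contDensitySpan_prop hY).1)]
    exact (abs_add_le _ _).trans (add_le_add (hC Λ hΛ hc) (hC' Λ hΛ hc))
  | smul a X hX ih =>
    obtain ⟨C, hC⟩ := ih
    refine ⟨|a| * C, fun Λ hΛ hc => ?_⟩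
    simp only [Pi.smul_apply, Matrix.mul_smul, trace_smul, Complex.smul_re, smul_eq_mul]
    rw [integral_const_mul, abs_mul]
    exact mul_le_mul_of_nonneg_left (hC Λ hΛ hc) (abs_nonneg a)

/-- A limit of a minimizing sequence solves the Minty variational inequality of the dual
problem. -/
theorem exists_minty (hA : IsStable A) (hW : IsSpectralFactor W Ψ) (hΨ : Continuous Ψ)
    (hΨp : ∀ z, (Ψ z).PosDef) (hΦ : Continuous Φ) (hΦp : ∀ z, (Φ z).PosDef)
    (hΦS : moment A B Φ = toC S) :
    ∃ Λ ∈ rangeGamma A B, (∀ z, (dualF A B Ψ Λ z).PosSemidef) ∧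
      ∀ Λ' ∈ rangeGamma A B, DualDom A B Ψ Λ' → gradJ A B S Ψ Λ' (Λ - Λ') ≤ 0 := by
  obtain ⟨C, hC⟩ := exists_J_lower_bound hA hW hΨ hΨp hΦ hΦp hΦS
  set D : Set (Matrix (Fin n) (Fin n) ℝ) := {Λ | Λ ∈ rangeGamma A B ∧ DualDom A B Ψ Λ} with hD
  have hne : (J A B S W '' D).Nonempty :=
    ⟨_, 0, ⟨(rangeSub hA B).zero_mem, dualDom_zero hΨp⟩, rfl⟩
  have hbdd : BddBelow (J A B S W '' D) := by
    refine ⟨-C, ?_⟩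
    rintro _ ⟨Λ, hΛ, rfl⟩
    have h0 : 0 ≤ ∫ z, (dualF A B Ψ Λ z * Φ z).trace.re ∂circleMeasure :=
      integral_nonneg fun z => trace_mul_nonneg (hΛ.2 z).posSemidef (hΦp z).posSemidef
    linarith [hC Λ hΛ.2]
  obtain ⟨u, -, hu, huD⟩ := exists_seq_tendsto_sInf hne hbdd
  choose Λ hΛD hΛu using huD
  obtain ⟨c, hc⟩ := hu.bddAbove_range
  have hcu : ∀ k, ∫ z, (dualF A B Ψ (Λ k) z * Φ z).trace.re ∂circleMeasure ≤ 2 * (c + C) := by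
    intro k
    have h1 := hC (Λ k) (hΛD k).2
    have h2 := hc ⟨k, rfl⟩
    rw [← hΛu k] at h2
    linarith
  have hentry : ∀ i j, ∃ K : ℝ, ∀ k, |Λ k i j| ≤ K := by
    intro i j
    obtain ⟨M, hM, hMe⟩ := exists_entry_eq_trace hA B i j
    obtain ⟨K, hK⟩ := exists_trace_bound hA hΨ hΨp hΦ hΦp (2 * (c + C)) hM
    exact ⟨K, fun k => by rw [hMe _ (hΛD k).1]; exact hK _ (hΛD k).2 (hcu k)⟩
  choose K hK using hentry
  have hcomp : IsCompact (Set.univ.pi fun i : Fin n => Set.univ.pi fun j : Fin n =>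
      Set.Icc (-K i j) (K i j) : Set (Fin n → Fin n → ℝ)) :=
    isCompact_univ_pi fun i => isCompact_univ_pi fun j => isCompact_Icc
  obtain ⟨Λb, -, φ, hφ, hlim⟩ := hcomp.tendsto_subseq (x := fun k i j => Λ k i j)
    fun k i _ j _ => abs_le.mp (hK i j k)
  have hlim' : Tendsto (fun k => Λ (φ k)) atTop (𝓝 (Matrix.of Λb)) := hlim
  have hclosed : IsClosed (rangeGamma A B) :=
    (rangeSub hA B).closed_of_finiteDimensional
  refine ⟨Matrix.of Λb, hclosed.mem_of_tendsto hlim' (.of_forall fun k => (hΛD _).1),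
    fun z => ?_, fun Λ' hΛ' hdom => ?_⟩
  · have hcont : Continuous fun Λ : Matrix (Fin n) (Fin n) ℝ => dualF A B Ψ Λ z :=
      continuous_const.add ((continuous_const.matrix_mul continuous_toC).matrix_mul
        continuous_const)
    exact isClosed_posSemidef.mem_of_tendsto ((hcont.tendsto _).comp hlim')
      (.of_forall fun k => ((hΛD _).2 z).posSemidef)
  -- The tangent at the interior point `Λ'` lies below `J` along the sequence and `J(Λ') ≥ inf J`.
  -- Passing to the limit in the tangent avoids evaluating `J` at a possible boundary point.
  · have h1 : ∀ k, gradJ A B S Ψ Λ' (Λ (φ k) - Λ') ≤ u (φ k) - sInf (J A B S W '' D) := by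
      intro k
      have h2 := (J_add_gradJ_le (S := S) hA hW hΨ hΨp hdom (hΛD (φ k)).2).1
      have h3 : sInf (J A B S W '' D) ≤ J A B S W Λ' := csInf_le hbdd ⟨Λ', ⟨hΛ', hdom⟩, rfl⟩
      rw [hΛu] at h2
      linarith
    have h4 : Tendsto (fun k => gradJ A B S Ψ Λ' (Λ (φ k) - Λ')) atTop
        (𝓝 (gradJ A B S Ψ Λ' (Matrix.of Λb - Λ'))) :=
      ((continuous_gradJ Λ').tendsto _).comp (hlim'.sub_const Λ')
    have h5 : Tendsto (fun k => u (φ k) - sInf (J A B S W '' D)) atTop (𝓝 0) := by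
      have := (hu.comp hφ.tendsto_atTop).sub_const (sInf (J A B S W '' D))
      rwa [sub_self] at this
    exact le_of_tendsto_of_tendsto' h4 h5 h1

/-! ### The solution is not on the boundary -/

theorem integral_inv_sub_add (θ₀ : ℝ) {δ t : ℝ} (hδ : 0 < δ) (ht : 0 < t) :
    ∫ θ in (θ₀ - δ)..θ₀, (θ₀ - θ + t)⁻¹ = Real.log ((δ + t) / t) := by
  have h := intervalIntegral.integral_comp_sub_left (a := θ₀ - δ) (b := θ₀)
    (fun x : ℝ => x⁻¹) (θ₀ + t)
  rw [show θ₀ + t - θ₀ = t by ring, show θ₀ + t - (θ₀ - δ) = δ + t by ring,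
    integral_inv_of_pos ht (by linarith)] at h
  rw [← h]
  congr 1; funext θ; congr 1; ring

/-- Detects logarithmic divergence as `t → 0`. The interval is one-sided so that it fits inside
`[-π, π]` even when `θ₀ = π`. -/
theorem log_le_integral_of_inv_le {g : Circle → ℝ} (hg : Continuous g) (hg0 : ∀ z, 0 ≤ g z)
    {θ₀ δ t c : ℝ} (hθ : θ₀ ≤ Real.pi) (hδ : 0 < δ) (hθδ : -Real.pi ≤ θ₀ - δ) (ht : 0 < t)
    (h : ∀ θ ∈ Set.Icc (θ₀ - δ) θ₀, c * (θ₀ - θ + t)⁻¹ ≤ g (Circle.exp θ)) :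
    c * Real.log ((δ + t) / t) ≤ 2 * Real.pi * ∫ z, g z ∂circleMeasure := by
  have hpi := Real.pi_pos
  have hgc : Continuous fun θ : ℝ => g (Circle.exp θ) := hg.comp Circle.exp.continuous
  have h1 : 2 * Real.pi * ∫ z, g z ∂circleMeasure
      = ∫ θ in (-Real.pi)..Real.pi, g (Circle.exp θ) := by
    rw [integral_circleMeasure hg, smul_eq_mul]; field_simp
  rw [h1, ← integral_inv_sub_add θ₀ hδ ht, ← intervalIntegral.integral_const_mul]
  have hci : IntervalIntegrable (fun θ => c * (θ₀ - θ + t)⁻¹) volume (θ₀ - δ) θ₀ := by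
    refine ContinuousOn.intervalIntegrable ?_
    rw [Set.uIcc_of_le (by linarith)]
    refine continuousOn_const.mul (ContinuousOn.inv₀ (by fun_prop) fun θ hθ' => ?_)
    have := hθ'.2
    linarith
  refine (intervalIntegral.integral_mono_on (by linarith) hci (hgc.intervalIntegrable _ _) h).trans
    ?_
  exact intervalIntegral.integral_mono_interval hθδ (by linarith) hθ
    (.of_forall fun θ => hg0 _) (hgc.intervalIntegrable _ _)

theorem differentiableAt_quad_dualF (hA : IsStable A) (hΨp : ∀ z, (Ψ z).PosDef)
    (hΨrat : IsRational Ψ) (Λ : Matrix (Fin n) (Fin n) ℝ) (v : Fin m → ℂ) (θ : ℝ) :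
    DifferentiableAt ℝ (fun t : ℝ => quad (dualF A B Ψ Λ (Circle.exp t)) v) θ := by
  have hR : ∀ i j, DifferentiableAt ℝ (fun t : ℝ =>
      (((Circle.exp t : Circle) : ℂ) • (1 : Matrix (Fin n) (Fin n) ℂ) - toC A)⁻¹ i j) θ := by
    refine differentiableAt_matrix_inv (F := fun t : ℝ =>
      ((Circle.exp t : Circle) : ℂ) • (1 : Matrix (Fin n) (Fin n) ℂ) - toC A) (fun i j => ?_)
      (hA.isUnit_det_circle _)
    simp only [Matrix.sub_apply, Matrix.smul_apply, smul_eq_mul, Circle.coe_exp]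
    fun_prop
  have hG' : ∀ i j, DifferentiableAt ℝ (fun t : ℝ => G A B (Circle.exp t) i j) θ :=
    differentiableAt_matrix_mul (H := fun _ : ℝ => toC B) hR
      fun i j => differentiableAt_const (toC B i j)
  have hGh : ∀ i j, DifferentiableAt ℝ (fun t : ℝ => (G A B (Circle.exp t))ᴴ i j) θ :=
    fun i j => (hG' j i).star
  have hF : ∀ i j, DifferentiableAt ℝ (fun t : ℝ => dualF A B Ψ Λ (Circle.exp t) i j) θ :=
    fun i j => (differentiableAt_matrix_inv (F := fun t : ℝ => Ψ (Circle.exp t))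
      (hΨrat.differentiableAt θ) (isUnit_det_of_posDef (hΨp _)) i j).add
      (differentiableAt_matrix_mul (F := fun t : ℝ => (G A B (Circle.exp t))ᴴ * toC Λ)
        (differentiableAt_matrix_mul (H := fun _ : ℝ => toC Λ) hGh
          fun i j => differentiableAt_const (toC Λ i j)) hG' i j)
  have hq : DifferentiableAt ℝ
      (fun t : ℝ => star v ⬝ᵥ (dualF A B Ψ Λ (Circle.exp t) *ᵥ v)) θ := by
    simp only [dotProduct, mulVec]
    exact DifferentiableAt.fun_sum fun i _ => (DifferentiableAt.fun_sum fun j _ =>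
      (hF i j).mul_const _).const_mul _
  exact Complex.reCLM.differentiableAt.comp θ hq

theorem exists_le_mul_abs_sub {f : ℝ → ℝ} {θ₀ : ℝ} (hf : DifferentiableAt ℝ f θ₀)
    (h0 : f θ₀ = 0) : ∃ K δ : ℝ, 0 < δ ∧ ∀ θ, |θ - θ₀| < δ → f θ ≤ K * |θ - θ₀| := by
  obtain ⟨K, hK⟩ := hf.isBigO_sub.bound
  obtain ⟨δ, hδ, h⟩ := Metric.eventually_nhds_iff.mp hK
  refine ⟨K, δ, hδ, fun θ hθ => ?_⟩
  have := h (by rwa [Real.dist_eq])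
  rw [h0, sub_zero, Real.norm_eq_abs, Real.norm_eq_abs] at this
  exact (le_abs_self _).trans this

/-- Minty's inequality at `(1-t)Λ` says that the derivative there in the direction `Λ` is
nonpositive. Substituting `G^* Λ' G = F_{Λ'} - Ψ⁻¹` for `Λ' = (1-t)Λ` turns it into this bound,
whose point is uniformity in `t`. -/
theorem integral_trace_inv_le (hA : IsStable A) (hΨ : Continuous Ψ) (hΨp : ∀ z, (Ψ z).PosDef)
    {Λ : Matrix (Fin n) (Fin n) ℝ} (hΛV : Λ ∈ rangeGamma A B)
    (hΛ : ∀ z, (dualF A B Ψ Λ z).PosSemidef)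
    (hminty : ∀ Λ' ∈ rangeGamma A B, DualDom A B Ψ Λ' → gradJ A B S Ψ Λ' (Λ - Λ') ≤ 0)
    {t : ℝ} (ht : 0 < t) (ht1 : t < 1) :
    DualDom A B Ψ ((1 - t) • Λ) ∧
    ∫ z, ((dualF A B Ψ ((1 - t) • Λ) z)⁻¹ * (Ψ z)⁻¹).trace.re ∂circleMeasure
      ≤ m + |(Λ * S).trace| := by
  have hdom : DualDom A B Ψ ((1 - t) • Λ) := by
    have := dualDom_convex hΛ (dualDom_zero hΨp) (sub_add_cancel 1 t) (by linarith) ht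
    rwa [smul_zero, add_zero] at this
  refine ⟨hdom, ?_⟩
  have h1 := hminty _ ((rangeSub hA B).smul_mem (1 - t) hΛV) hdom
  rw [show Λ - (1 - t) • Λ = t • Λ by rw [sub_smul, one_smul, sub_sub_cancel], gradJ_smul] at h1
  have h2 : gradJ A B S Ψ ((1 - t) • Λ) ((1 - t) • Λ) ≤ 0 := by
    rw [gradJ_smul]
    exact mul_nonpos_of_nonneg_of_nonpos (by linarith) (nonpos_of_mul_nonpos_right h1 ht)
  rw [gradJ_eq hA hΨ hΨp hdom] at h2
  have hi := continuous_inv_of_posDef (continuous_dualF (B := B) hA hΨ hΨp ((1 - t) • Λ)) hdom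
  have h3 : ∀ z, ((dualF A B Ψ ((1 - t) • Λ) z)⁻¹ * hG A B ((1 - t) • Λ) z).trace.re
      = m - ((dualF A B Ψ ((1 - t) • Λ) z)⁻¹ * (Ψ z)⁻¹).trace.re := by
    intro z
    have e : hG A B ((1 - t) • Λ) z = dualF A B Ψ ((1 - t) • Λ) z - (Ψ z)⁻¹ := by
      rw [dualF, add_sub_cancel_left]
    rw [e, Matrix.mul_sub, Matrix.nonsing_inv_mul _ (isUnit_det_of_posDef (hdom z))]
    simp
  simp only [h3] at h2
  rw [integral_sub (integrable_const _) (EssBdd.of_continuous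
    (hi.matrix_mul (continuous_inv_of_posDef hΨ hΨp))).integrable_trace_re] at h2
  simp only [integral_const, probReal_univ, Matrix.smul_mul, trace_smul,
    smul_eq_mul] at h2
  have h4 : -|(Λ * S).trace| ≤ (1 - t) * (Λ * S).trace := by
    have := neg_abs_le (Λ * S).trace
    have := abs_nonneg (Λ * S).trace
    nlinarith
  linarith

/-- If `v` spans a degenerate direction at `z₀`, then `v^* F_{(1-t)Λ} v ≤ K(|θ - θ₀| + t)` near
`z₀`, so `tr(F_{(1-t)Λ}⁻¹ Ψ⁻¹)` is at least a multiple of `1/(|θ - θ₀| + t)`. Its integral is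
unbounded as `t → 0`, contradicting the uniform bound. -/
theorem dualDom_of_minty (hA : IsStable A) (hΨp : ∀ z, (Ψ z).PosDef) (hΨrat : IsRational Ψ)
    {Λ : Matrix (Fin n) (Fin n) ℝ} (hΛV : Λ ∈ rangeGamma A B)
    (hΛ : ∀ z, (dualF A B Ψ Λ z).PosSemidef)
    (hminty : ∀ Λ' ∈ rangeGamma A B, DualDom A B Ψ Λ' → gradJ A B S Ψ Λ' (Λ - Λ') ≤ 0) :
    DualDom A B Ψ Λ := by
  by_contra hcon
  obtain ⟨z₀, hz₀⟩ := not_forall.mp hcon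
  obtain ⟨v, hv, hv0⟩ : ∃ v, v ≠ 0 ∧ quad (dualF A B Ψ Λ z₀) v = 0 := by
    by_contra! h
    exact hz₀ (posDef_of_forall_re (hΛ z₀).1 fun v hv =>
      lt_of_le_of_ne ((hΛ z₀).re_dotProduct_nonneg v) (h v hv).symm)
  have hΨ := hΨrat.continuous
  have hΨi := continuous_inv_of_posDef hΨ hΨp
  obtain ⟨κ, hκ⟩ := exists_smul_sub_posSemidef hΨi (fun z => (hΨp z).inv)
    (Y := fun _ => vecMulVec v (star v)) continuous_const
    fun _ => (posSemidef_vecMulVec_self_star v).1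
  set θ₀ := Complex.arg z₀ with hθ₀
  have hexp : Circle.exp θ₀ = z₀ := Circle.exp_arg z₀
  have hθpi : θ₀ ≤ Real.pi := Complex.arg_le_pi _
  have hθpi' : -Real.pi < θ₀ := Complex.neg_pi_lt_arg _
  obtain ⟨K₁, δ₁, hδ₁, hK₁⟩ := exists_le_mul_abs_sub
    (differentiableAt_quad_dualF hA hΨp hΨrat Λ v θ₀) (by rw [hexp]; exact hv0)
  obtain ⟨K₂, hK₂⟩ := (isCompact_range (continuous_quad hΨi
    (continuous_const (y := v)))).bddAbove
  set K := |K₁| + |K₂| + 1 with hKdef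
  have hK : 0 < K := by positivity
  -- `δ₁ / 2` keeps the closed interval inside the open range of the linear estimate; `θ₀ + π` keeps
  -- it inside `[-π, π]`.
  set δ := min (δ₁ / 2) (θ₀ + Real.pi) with hδdef
  have hδ : 0 < δ := lt_min (by linarith) (by linarith)
  have hδl : δ ≤ δ₁ / 2 := min_le_left _ _
  have hδr : δ ≤ θ₀ + Real.pi := min_le_right _ _
  set a := (star v ⬝ᵥ v).re with hadef
  have ha : 0 < a := by
    have := (PosDef.one (n := Fin m) (R := ℂ)).re_dotProduct_pos hv
    simpa using this
  set c := a ^ 2 / K with hcdef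
  have hc : 0 < c := by positivity
  have hlog : ∀ t : ℝ, 0 < t → t < 1 →
      c * Real.log ((δ + t) / t) ≤ 2 * Real.pi * (|κ| * (m + |(Λ * S).trace|)) := by
    intro t ht ht1
    obtain ⟨hdom, hint⟩ := integral_trace_inv_le hA hΨ hΨp hΛV hΛ hminty ht ht1
    have hFi := continuous_inv_of_posDef (continuous_dualF (B := B) hA hΨ hΨp ((1 - t) • Λ)) hdom
    set g : Circle → ℝ := fun z =>
      κ * ((dualF A B Ψ ((1 - t) • Λ) z)⁻¹ * (Ψ z)⁻¹).trace.re with hg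
    have hgc : Continuous g := continuous_const.mul
      (Complex.continuous_re.comp (hFi.matrix_mul hΨi).matrix_trace)
    have hle : ∀ z, a ^ 2 / quad (dualF A B Ψ ((1 - t) • Λ) z) v ≤ g z := fun z =>
      le_trace_inv_mul (hdom z) hv (hκ z)
    have hqp : ∀ z, 0 < quad (dualF A B Ψ ((1 - t) • Λ) z) v := fun z =>
      (hdom z).re_dotProduct_pos hv
    have hg0 : ∀ z, 0 ≤ g z := fun z =>
      (div_nonneg (sq_nonneg a) (hqp z).le).trans (hle z)
    have hgI : ∫ z, g z ∂circleMeasure ≤ |κ| * (m + |(Λ * S).trace|) := by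
      have h0 : 0 ≤ ∫ z, ((dualF A B Ψ ((1 - t) • Λ) z)⁻¹ * (Ψ z)⁻¹).trace.re ∂circleMeasure :=
        integral_nonneg fun z =>
          trace_mul_nonneg (hdom z).inv.posSemidef (hΨp z).inv.posSemidef
      rw [hg, integral_const_mul]
      exact (mul_le_mul_of_nonneg_right (le_abs_self κ) h0).trans
        (mul_le_mul_of_nonneg_left hint (abs_nonneg κ))
    refine (log_le_integral_of_inv_le hgc hg0 hθpi hδ (by linarith) ht fun θ hθ => ?_).trans
      (mul_le_mul_of_nonneg_left hgI (by positivity))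
    refine le_trans ?_ (hle _)
    have hab : |θ - θ₀| = θ₀ - θ := by
      rw [abs_sub_comm, abs_of_nonneg (by linarith [hθ.2])]
    have hθt : 0 < θ₀ - θ + t := by linarith [hθ.2]
    have h1 : quad (dualF A B Ψ Λ (Circle.exp θ)) v ≤ |K₁| * (θ₀ - θ) := by
      have := hK₁ θ (by rw [hab]; linarith [hθ.1])
      rw [hab] at this
      exact this.trans (mul_le_mul_of_nonneg_right (le_abs_self _) (by linarith [hθ.2]))
    have h2 : quad (Ψ (Circle.exp θ))⁻¹ v ≤ |K₂| := (hK₂ ⟨_, rfl⟩).trans (le_abs_self _)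
    have h3 : quad (dualF A B Ψ ((1 - t) • Λ) (Circle.exp θ)) v
        = (1 - t) * quad (dualF A B Ψ Λ (Circle.exp θ)) v
          + t * quad (Ψ (Circle.exp θ))⁻¹ v := by
      have := dualF_convex (A := A) (B := B) (Ψ := Ψ) (1 - t) t (sub_add_cancel 1 t) Λ 0
        (Circle.exp θ)
      rw [smul_zero, add_zero, dualF_zero] at this
      rw [this, quad_add, quad_smul, quad_smul]
    have h4 : 0 ≤ quad (dualF A B Ψ Λ (Circle.exp θ)) v := (hΛ _).re_dotProduct_nonneg v
    have h5 : quad (dualF A B Ψ ((1 - t) • Λ) (Circle.exp θ)) v ≤ K * (θ₀ - θ + t) := by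
      rw [h3]
      have e1 : (1 - t) * quad (dualF A B Ψ Λ (Circle.exp θ)) v ≤ |K₁| * (θ₀ - θ) := by nlinarith
      have e2 : t * quad (Ψ (Circle.exp θ))⁻¹ v ≤ t * |K₂| :=
        mul_le_mul_of_nonneg_left h2 ht.le
      have e3 : 0 ≤ (|K₂| + 1) * (θ₀ - θ) :=
        mul_nonneg (by positivity) (by linarith [hθ.2])
      have e4 : 0 ≤ (|K₁| + 1) * t := by positivity
      rw [hKdef]; linarith
    rw [hcdef, div_mul_eq_mul_div, ← div_eq_mul_inv, div_div, mul_comm _ K]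
    exact div_le_div_of_nonneg_left (sq_nonneg a) (hqp _) h5
  set C := 2 * Real.pi * (|κ| * (m + |(Λ * S).trace|)) with hC
  -- `t` is so small that `log((δ + t)/t) ≥ C/c + 1`, which turns `hlog` into `C + c ≤ C`; the `1/2`
  -- ensures `t < 1`.
  set t := min (1 / 2) (δ * Real.exp (-(C / c + 1))) with htdef
  have ht : 0 < t := lt_min (by norm_num) (by positivity)
  have h1 := hlog t ht ((min_le_left _ _).trans_lt (by norm_num))
  have h2 : Real.exp (C / c + 1) ≤ (δ + t) / t := by
    rw [le_div_iff₀ ht]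
    have : Real.exp (C / c + 1) * t ≤ Real.exp (C / c + 1) * (δ * Real.exp (-(C / c + 1))) :=
      mul_le_mul_of_nonneg_left (min_le_right _ _) (Real.exp_pos _).le
    rw [mul_left_comm, ← Real.exp_add, add_neg_cancel, Real.exp_zero, mul_one] at this
    linarith
  have h3 := (Real.le_log_iff_exp_le (by positivity)).mpr h2
  have h4 : c * (C / c + 1) ≤ C := (mul_le_mul_of_nonneg_left h3 hc.le).trans h1
  rw [mul_add, mul_div_cancel₀ _ hc.ne'] at h4
  linarith

/-! ### Stationarity -/

/-- The reparametrization `cl` keeps the whole path in the domain, so the inverse is jointly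
continuous in the parameter and the point, and the integral over the compact circle is continuous.
-/
theorem continuous_gradJ_path (hA : IsStable A) (hΨ : Continuous Ψ)
    (hΨp : ∀ z, (Ψ z).PosDef) {Λ D : Matrix (Fin n) (Fin n) ℝ} {cl : ℝ → ℝ} (hcl : Continuous cl)
    (hcldom : ∀ s, DualDom A B Ψ (Λ + cl s • D)) :
    Continuous fun s => gradJ A B S Ψ (Λ + cl s • D) D := by
  have hFc : Continuous fun p : ℝ × Circle => dualF A B Ψ (Λ + cl p.1 • D) p.2 := by
    have e : ∀ p : ℝ × Circle, dualF A B Ψ (Λ + cl p.1 • D) p.2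
        = dualF A B Ψ Λ p.2 + ((cl p.1 : ℝ) : ℂ) • hG A B D p.2 := fun p => by
      rw [dualF, dualF, hG_add, hG_smul, add_assoc]
    simp only [e]
    exact ((continuous_dualF hA hΨ hΨp Λ).comp continuous_snd).add
      ((Complex.continuous_ofReal.comp (hcl.comp continuous_fst)).smul
        ((continuous_hG hA D).comp continuous_snd))
  simp only [fun s => gradJ_eq (S := S) hA hΨ hΨp (hcldom s) D]
  refine continuous_const.sub ?_
  have hjoint : Continuous (Function.uncurry fun (s : ℝ) (z : Circle) =>
      ((dualF A B Ψ (Λ + cl s • D) z)⁻¹ * hG A B D z).trace.re) :=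
    Complex.continuous_re.comp ((continuous_inv_of_isUnit hFc fun p =>
      isUnit_det_of_posDef (hcldom p.1 p.2)).matrix_mul
        ((continuous_hG hA D).comp continuous_snd)).matrix_trace
  have := continuous_parametric_integral_of_continuous (μ := circleMeasure) hjoint
    (s := Set.univ) isCompact_univ
  simpa only [Measure.restrict_univ] using this

theorem exists_dualDom_add_smul (hA : IsStable A) (hW : IsSpectralFactor W Ψ)
    (hΨ : Continuous Ψ) (hΨp : ∀ z, (Ψ z).PosDef) {Λ D : Matrix (Fin n) (Fin n) ℝ}
    (hmem : ∀ s : ℝ, Λ + s • D ∈ rangeGamma A B) (hΛ : DualDom A B Ψ Λ) :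
    ∃ ε : ℝ, 0 < ε ∧ ∀ s : ℝ, |s| < ε → DualDom A B Ψ (Λ + s • D) := by
  have hι : Continuous fun s : ℝ => (⟨Λ + s • D, hmem s⟩ : rangeGamma A B) :=
    Continuous.subtype_mk (continuous_const.add (continuous_id.smul continuous_const)) _
  have hopen := (isOpen_LplusGamma hA hW hΨ hΨp).preimage hι
  have h0 : (⟨Λ + (0 : ℝ) • D, hmem 0⟩ : rangeGamma A B) ∈ LplusGamma A B W := by
    rw [mem_LplusGamma_iff hW hΨp]
    change DualDom A B Ψ (Λ + (0 : ℝ) • D)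
    rwa [zero_smul, add_zero]
  obtain ⟨ε, hε, hball⟩ := Metric.isOpen_iff.mp hopen 0 h0
  refine ⟨ε, hε, fun s hs => (mem_LplusGamma_iff hW hΨp ⟨Λ + s • D, hmem s⟩).mp (hball ?_)⟩
  rwa [Metric.mem_ball, Real.dist_0_eq_abs]

/-- Minty's inequality at `Λ + sD` makes the derivative there along `D` nonnegative for small `s >
0`; let `s → 0`. -/
theorem gradJ_nonneg_of_minty (hA : IsStable A) (hW : IsSpectralFactor W Ψ) (hΨ : Continuous Ψ)
    (hΨp : ∀ z, (Ψ z).PosDef) {Λ D : Matrix (Fin n) (Fin n) ℝ} (hΛV : Λ ∈ rangeGamma A B)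
    (hDV : D ∈ rangeGamma A B) (hΛ : DualDom A B Ψ Λ)
    (hminty : ∀ Λ' ∈ rangeGamma A B, DualDom A B Ψ Λ' → gradJ A B S Ψ Λ' (Λ - Λ') ≤ 0) :
    0 ≤ gradJ A B S Ψ Λ D := by
  have hmem : ∀ s : ℝ, Λ + s • D ∈ rangeGamma A B := fun s =>
    (rangeSub hA B).add_mem hΛV ((rangeSub hA B).smul_mem s hDV)
  obtain ⟨ε, hε, hdom⟩ := exists_dualDom_add_smul hA hW hΨ hΨp hmem hΛ
  obtain ⟨cl, hcl, hcl0, hclε, hclp⟩ : ∃ cl : ℝ → ℝ, Continuous cl ∧ cl 0 = 0 ∧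
      (∀ s, |cl s| < ε) ∧ ∀ s, 0 < s → 0 < cl s := by
    refine ⟨fun s => max 0 (min s (ε / 2)), by fun_prop, by simp, fun s => ?_,
      fun s hs => lt_max_of_lt_right (lt_min hs (by linarith))⟩
    rw [abs_of_nonneg (le_max_left _ _)]
    exact max_lt hε ((min_le_right _ _).trans_lt (by linarith))
  have hcldom : ∀ s, DualDom A B Ψ (Λ + cl s • D) := fun s => hdom _ (hclε s)
  have hcont := continuous_gradJ_path (S := S) hA hΨ hΨp hcl hcldom
  have hpos : ∀ s ∈ Set.Ioi (0 : ℝ), 0 ≤ gradJ A B S Ψ (Λ + cl s • D) D := by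
    intro s hs
    have h1 := hminty _ (hmem (cl s)) (hcldom s)
    rw [show Λ - (Λ + cl s • D) = (-cl s) • D by rw [neg_smul]; abel, gradJ_smul, neg_mul,
      neg_nonpos] at h1
    exact nonneg_of_mul_nonneg_right h1 (hclp s hs)
  have h2 : (0 : ℝ) ∈ closure (Set.Ioi (0 : ℝ)) := by rw [closure_Ioi]; exact Set.self_mem_Ici
  have h3 : 0 ≤ gradJ A B S Ψ (Λ + cl 0 • D) D :=
    closure_minimal (t := {s | 0 ≤ gradJ A B S Ψ (Λ + cl s • D) D}) hpos
      (isClosed_le continuous_const hcont) h2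
  rwa [hcl0, zero_smul, add_zero] at h3

/-- Existence of a dual solution matching the state covariance. -/
theorem exists_dual_solution (hA : IsStable A) (hW : IsSpectralFactor W Ψ)
    (hΨp : ∀ z, (Ψ z).PosDef) (hΨs : ConjSymm Ψ) (hΨrat : IsRational Ψ)
    (hΦ : Continuous Φ) (hΦp : ∀ z, (Φ z).PosDef) (hΦs : ConjSymm Φ)
    (hΦS : moment A B Φ = toC S) :
    ∃ Λ ∈ rangeGamma A B, DualDom A B Ψ Λ ∧ moment A B (PhiOpt A B Ψ Λ) = toC S := by
  have hΨ := hΨrat.continuous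
  obtain ⟨Λ, hΛV, hΛ, hminty⟩ := exists_minty hA hW hΨ hΨp hΦ hΦp hΦS
  have hdom := dualDom_of_minty hA hΨp hΨrat hΛV hΛ hminty
  refine ⟨Λ, hΛV, hdom, ?_⟩
  have hSV : S ∈ rangeGamma A B := by
    obtain ⟨-, M, hM, hMS⟩ := exists_mem_rangeGamma (A := A) (B := B) hΦ hΦs
      fun z => (hΦp z).posSemidef
    rwa [toC_injective (hMS.trans hΦS)] at hM
  obtain ⟨-, M, hM, hMΛ⟩ := exists_mem_rangeGamma (A := A) (B := B)
    (continuous_phiOpt hA hΨ hΨp hdom) (conjSymm_dualF hΨs Λ).inv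
    fun z => (hdom z).inv.posSemidef
  -- The test direction is the moment defect itself: the derivative along it is `-tr((M - S)²)`, and
  -- nonnegativity forces `M = S`.
  have hD : M - S ∈ rangeGamma A B := (rangeSub hA B).sub_mem hM hSV
  have h1 := gradJ_nonneg_of_minty hA hW hΨ hΨp hΛV hD hdom hminty
  have h2 : gradJ A B S Ψ Λ (M - S) = -((M - S)ᴴ * (M - S)).trace := by
    rw [conjTranspose_eq_transpose_of_trivial, (isSymm_of_mem_rangeGamma hD).eq, gradJ, ← hMΛ,
      ← toC_mul, toC_trace_re, Matrix.mul_sub (M - S), trace_sub]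
    ring
  have h3 : 0 ≤ ((M - S)ᴴ * (M - S)).trace := (posSemidef_conjTranspose_mul_self _).trace_nonneg
  have h4 := trace_conjTranspose_mul_self_eq_zero_iff.mp (le_antisymm (by linarith) h3)
  rw [← hMΛ, sub_eq_zero.mp h4]

end Existence

/-! ### Strict comparison on the closure and primal optimality. -/

section Optimality

variable {n m : ℕ} {A : Matrix (Fin n) (Fin n) ℝ} {B : Matrix (Fin n) (Fin m) ℝ}
  {S : Matrix (Fin n) (Fin n) ℝ} {Ψ W Φ : Circle → Matrix (Fin m) (Fin m) ℂ}

/-- The midpoint of `Λ` and `Λ₀` is interior, with `J` strictly larger than at `Λ₀`. Hence `J`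
decreases from it towards `Λ₀`, and its tangent rises in the opposite direction, towards `Λ`. The
regularized values at `Λ` lie above this tangent up to an error of order `ε`. -/
theorem J_lt_Jinf (hA : IsStable A) (hW : IsSpectralFactor W Ψ) (hΨ : Continuous Ψ)
    (hΨp : ∀ z, (Ψ z).PosDef) {Λ₀ Λ : Matrix (Fin n) (Fin n) ℝ} (hΛ₀V : Λ₀ ∈ rangeGamma A B)
    (hΛ₀ : DualDom A B Ψ Λ₀) (hmom : moment A B (PhiOpt A B Ψ Λ₀) = toC S)
    (hΛV : Λ ∈ rangeGamma A B) (hΛ : ∀ z, (dualF A B Ψ Λ z).PosSemidef) (hne : Λ ≠ Λ₀) :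
    ((J A B S W Λ₀ : ℝ) : EReal) < Jinf A B S W Λ := by
  set Λt : Matrix (Fin n) (Fin n) ℝ := (1 / 2 : ℝ) • Λ + (1 / 2 : ℝ) • Λ₀ with hΛt
  have hdom : DualDom A B Ψ Λt := dualDom_convex hΛ hΛ₀ (by norm_num) (by norm_num) (by norm_num)
  have hΛtV : Λt ∈ rangeGamma A B := (rangeSub hA B).add_mem
    ((rangeSub hA B).smul_mem _ hΛV) ((rangeSub hA B).smul_mem _ hΛ₀V)
  have hsub : Λ - Λt = (-1 : ℝ) • (Λ₀ - Λt) := by rw [hΛt]; module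
  have hsub' : Λ - Λ₀ = (2 : ℝ) • (Λt - Λ₀) := by rw [hΛt]; module
  obtain ⟨h1, h2⟩ := J_add_gradJ_le (S := S) hA hW hΨ hΨp hΛ₀ hdom
  rw [gradJ_eq_zero hmom, add_zero] at h1 h2
  have h3 : J A B S W Λ₀ < J A B S W Λt := lt_of_le_of_ne h1 fun h => hne <| by
    rw [← sub_eq_zero, hsub', h2 hΛ₀V hΛtV h, sub_self, smul_zero]
  have h4 := (J_add_gradJ_le (S := S) hA hW hΨ hΨp hdom hΛ₀).1
  set c := ∫ z, ((dualF A B Ψ Λt z)⁻¹ * (Ψ z)⁻¹).trace.re ∂circleMeasure with hc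
  -- One `k` making the error smaller than the gap suffices, as `Jinf` is a supremum.
  obtain ⟨k, hk⟩ := exists_nat_one_div_lt
    (show 0 < (J A B S W Λt - J A B S W Λ₀) / (|c| + 1) from
      div_pos (by linarith) (by positivity))
  have hkp : (0 : ℝ) < 1 / ((k : ℝ) + 1) := by positivity
  have h5 := J_add_gradJ_le_Jreg (S := S) hA hW hΨ hΨp hdom hΛ hkp
  rw [hsub, gradJ_smul, ← hc] at h5
  have h6 : 1 / ((k : ℝ) + 1) * c < J A B S W Λt - J A B S W Λ₀ := by
    have h7 := (lt_div_iff₀ (by positivity)).mp hk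
    have h8 : 1 / ((k : ℝ) + 1) * c ≤ 1 / ((k : ℝ) + 1) * (|c| + 1) :=
      mul_le_mul_of_nonneg_left (by linarith [le_abs_self c]) hkp.le
    linarith
  have h9 : J A B S W Λ₀ < Jreg A B S W (1 / ((k : ℝ) + 1)) Λ := by linarith
  exact (EReal.coe_lt_coe_iff.mpr h9).trans_le
    (le_iSup (fun k : ℕ => ((Jreg A B S W (1 / ((k : ℝ) + 1)) Λ : ℝ) : EReal)) k)

theorem integral_sub_add_sub {f₁ f₂ f₃ f₄ : Circle → ℝ} (h₁ : Integrable f₁ circleMeasure)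
    (h₂ : Integrable f₂ circleMeasure) (h₃ : Integrable f₃ circleMeasure)
    (h₄ : Integrable f₄ circleMeasure) :
    ∫ z, ((f₁ z - f₂ z) + (f₃ z - f₄ z)) ∂circleMeasure
      = (∫ z, f₁ z ∂circleMeasure - ∫ z, f₂ z ∂circleMeasure)
        + (∫ z, f₃ z ∂circleMeasure - ∫ z, f₄ z ∂circleMeasure) := by
  rw [← integral_sub h₁ h₂, ← integral_sub h₃ h₄]
  exact integral_add (h₁.sub h₂) (h₃.sub h₄)

theorem dRER_eq (hΨ : Continuous Ψ) (hΨp : ∀ z, (Ψ z).PosDef) (hΦ : IsBddCoerciveDensity Φ) :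
    dRER Φ Ψ = 1 / 2 * (∫ z, logDet (Ψ z) ∂circleMeasure - ∫ z, logDet (Φ z) ∂circleMeasure
      + ∫ z, ((Ψ z)⁻¹ * Φ z).trace.re ∂circleMeasure - m) := by
  have h1 := integrable_of_continuous (continuous_logDet hΨ hΨp)
  have h2 := hΦ.integrable_logDet
  have h3 : Integrable (fun z => ((Ψ z)⁻¹ * Φ z).trace.re) circleMeasure :=
    ((EssBdd.of_continuous (continuous_inv_of_posDef hΨ hΨp)).mul hΦ.essBdd).integrable_trace_re
  have h4 : ∫ z, (Real.log ((Φ z)⁻¹ * Ψ z).det.re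
      + ((Ψ z)⁻¹ * (Φ z - Ψ z)).trace.re) ∂circleMeasure
      = ∫ z, ((logDet (Ψ z) - logDet (Φ z)) + (((Ψ z)⁻¹ * Φ z).trace.re - m))
        ∂circleMeasure := by
    refine integral_congr_ae ?_
    filter_upwards [hΦ.ae_posDef] with z hz
    rw [logDet_mul hz.inv (hΨp z), logDet_inv hz, trace_inv_mul_sub (hΨp z)]
    ring
  rw [dRER, h4, integral_sub_add_sub h1 h2 h3 (integrable_const _)]
  simp only [integral_const, probReal_univ, one_smul]
  ring

/-- The density associated with a dual solution minimizes the relative entropy rate, and only it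
does. -/
theorem dRER_phiOpt_le (hA : IsStable A) (hΨ : Continuous Ψ) (hΨp : ∀ z, (Ψ z).PosDef)
    (hΨs : ConjSymm Ψ) {Λ : Matrix (Fin n) (Fin n) ℝ} (hΛ : DualDom A B Ψ Λ)
    (hmom : moment A B (PhiOpt A B Ψ Λ) = toC S) (hΦ : Φ ∈ feasible A B S) :
    dRER (PhiOpt A B Ψ Λ) Ψ ≤ dRER Φ Ψ ∧
    (dRER Φ Ψ ≤ dRER (PhiOpt A B Ψ Λ) Ψ → Φ =ᵐ[circleMeasure] PhiOpt A B Ψ Λ) := by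
  obtain ⟨hΦb, hΦS⟩ := hΦ
  have hXb := isBddCoerciveDensity_phiOpt hA hΨ hΨp hΨs hΛ
  have hXc := continuous_phiOpt hA hΨ hΨp hΛ
  have hXp : ∀ z, (PhiOpt A B Ψ Λ z).PosDef := fun z => (hΛ z).inv
  have hXi : ∀ z, (PhiOpt A B Ψ Λ z)⁻¹ = dualF A B Ψ Λ z := fun z =>
    Matrix.nonsing_inv_nonsing_inv _ (isUnit_det_of_posDef (hΛ z))
  obtain ⟨h1, h2⟩ := integral_logDet_le hXc hXp hΦb.essBdd hΦb.ae_posDef hΦb.integrable_logDet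
  have hi : ∀ {Y : Circle → Matrix (Fin m) (Fin m) ℂ}, EssBdd Y →
      Integrable (fun z => ((Ψ z)⁻¹ * Y z).trace.re) circleMeasure := fun hY =>
    ((EssBdd.of_continuous (continuous_inv_of_posDef hΨ hΨp)).mul hY).integrable_trace_re
  have hh : ∀ {Y : Circle → Matrix (Fin m) (Fin m) ℂ}, EssBdd Y →
      Integrable (fun z => (hG A B Λ z * Y z).trace.re) circleMeasure := fun hY =>
    ((EssBdd.of_continuous (continuous_hG hA Λ)).mul hY).integrable_trace_re
  -- As `Φ°⁻¹ = Ψ⁻¹ + G^* Λ G`, the `Λ` part integrates to `tr(ΛS)` for both densities and cancels.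
  -- The difference of the two distances is then half the tangent gap of `∫ log det` at `Φ°`.
  have h3 : ∫ z, ((PhiOpt A B Ψ Λ z)⁻¹ * (Φ z - PhiOpt A B Ψ Λ z)).trace.re ∂circleMeasure
      = ∫ z, ((Ψ z)⁻¹ * Φ z).trace.re ∂circleMeasure
        - ∫ z, ((Ψ z)⁻¹ * PhiOpt A B Ψ Λ z).trace.re ∂circleMeasure := by
    have e : ∀ z, ((PhiOpt A B Ψ Λ z)⁻¹ * (Φ z - PhiOpt A B Ψ Λ z)).trace.re
        = (((Ψ z)⁻¹ * Φ z).trace.re - ((Ψ z)⁻¹ * PhiOpt A B Ψ Λ z).trace.re)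
          + ((hG A B Λ z * Φ z).trace.re - (hG A B Λ z * PhiOpt A B Ψ Λ z).trace.re) := by
      intro z
      rw [hXi, dualF, Matrix.add_mul, Matrix.mul_sub, Matrix.mul_sub]
      simp only [trace_add, trace_sub, Complex.add_re, Complex.sub_re]
    simp only [e]
    rw [integral_sub_add_sub (hi hΦb.essBdd) (hi hXb.essBdd) (hh hΦb.essBdd) (hh hXb.essBdd),
      ← trace_mul_eq_integral hA hΦb.essBdd hΦS, ← trace_mul_eq_integral hA hXb.essBdd hmom,
      sub_self, add_zero]
  rw [h3] at h1 h2
  rw [dRER_eq hΨ hΨp hΦb, dRER_eq hΨ hΨp hXb]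
  exact ⟨by linarith, fun h => h2 (by linarith)⟩

end Optimality

end

end RER

/-! ### The main theorem. -/

theorem mainTheorem2 (m n : ℕ) (hm : 0 < m) (hmn : m ≤ n)
    (A : Matrix (Fin n) (Fin n) ℝ) (B : Matrix (Fin n) (Fin m) ℝ)
    (hA : RER.IsStable A) (hB : B.rank = m) (hAB : RER.IsReachable A B)
    (S : Matrix (Fin n) (Fin n) ℝ) (hS : S.PosDef)
    (hfeas : ∃ H : Matrix (Fin m) (Fin n) ℝ, S - A * S * Aᵀ = B * H + Hᵀ * Bᵀ)
    (Ψ : Circle → Matrix (Fin m) (Fin m) ℂ)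
    (hΨ : RER.IsBddCoerciveDensity Ψ) (hΨrat : RER.IsRational Ψ)
    (W : Circle → Matrix (Fin m) (Fin m) ℂ) (hW : RER.IsSpectralFactor W Ψ) :
    -- the domain of the dual problem is open in `Range Γ` and unbounded
    IsOpen (RER.LplusGamma A B W) ∧
    (¬ ∃ C : ℝ, ∀ Λ ∈ RER.LplusGamma A B W, ∀ i j, |Λ.1 i j| ≤ C) ∧
    ∃ Λ₀ : RER.rangeGamma A B,
      -- `Λ₀` is the unique minimizer of the dual functional
      Λ₀ ∈ RER.LplusGamma A B W ∧
      (∀ Λ ∈ RER.LplusGamma A B W, RER.J A B S W Λ₀ ≤ RER.J A B S W Λ) ∧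
      (∀ Λ₁ ∈ RER.LplusGamma A B W,
        (∀ Λ ∈ RER.LplusGamma A B W, RER.J A B S W Λ₁ ≤ RER.J A B S W Λ) → Λ₁ = Λ₀) ∧
      -- it is an interior point, and the minimum over the closure is attained only there
      Λ₀ ∈ interior (RER.LplusGamma A B W) ∧
      Λ₀ ∉ frontier (RER.LplusGamma A B W) ∧
      (∀ Λ ∈ closure (RER.LplusGamma A B W), Λ ≠ Λ₀ →
        ((RER.J A B S W Λ₀ : ℝ) : EReal) < RER.Jinf A B S W Λ) ∧
      -- `Φ°` satisfies the moment constraint and is the unique solution of the primal problem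
      RER.moment A B (RER.PhiOpt A B Ψ Λ₀) = RER.toC S ∧
      RER.IsSolution A B S Ψ (RER.PhiOpt A B Ψ Λ₀) ∧
      (∀ Φ, RER.IsSolution A B S Ψ Φ → Φ =ᵐ[RER.circleMeasure] RER.PhiOpt A B Ψ Λ₀) := by
  have hΨc := hΨrat.continuous
  have hΨp := hΨ.posDef_of_continuous hΨc
  have hΨs := hΨ.conjSymm_of_continuous hΨc
  have hopen := RER.isOpen_LplusGamma (B := B) hA hW hΨc hΨp
  refine ⟨hopen, RER.unbounded_LplusGamma hm hA hB hW hΨp, ?_⟩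
  obtain ⟨Φ, hΦc, hΦs, hΦp, hΦS⟩ := RER.exists_density hA hB hS hfeas
  obtain ⟨Λ₀, hΛ₀V, hdom, hmom⟩ :=
    RER.exists_dual_solution hA hW hΨp hΨs hΨrat hΦc hΦp hΦs hΦS
  have hmem : (⟨Λ₀, hΛ₀V⟩ : RER.rangeGamma A B) ∈ RER.LplusGamma A B W :=
    (RER.mem_LplusGamma_iff hW hΨp _).mpr hdom
  have hint := hopen.interior_eq.symm ▸ hmem
  have hJ := fun Λ (hΛ : Λ ∈ RER.LplusGamma A B W) =>
    RER.J_add_gradJ_le (S := S) hA hW hΨc hΨp hdom ((RER.mem_LplusGamma_iff hW hΨp Λ).mp hΛ)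
  -- With vanishing derivative the tangent inequality at `Λ₀` is global minimality, and its equality
  -- case is uniqueness.
  simp only [RER.gradJ_eq_zero hmom, add_zero] at hJ
  have hfe : RER.PhiOpt A B Ψ Λ₀ ∈ RER.feasible A B S :=
    ⟨RER.isBddCoerciveDensity_phiOpt hA hΨc hΨp hΨs hdom, hmom⟩
  refine ⟨⟨Λ₀, hΛ₀V⟩, hmem, fun Λ hΛ => (hJ Λ hΛ).1, fun Λ₁ hΛ₁ h => ?_, hint, fun h => h.2 hint,
    fun Λ hΛ hne => ?_, hmom, ⟨hfe, fun Φ' hΦ' => ?_⟩, fun Φ' hΦ' => ?_⟩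
  · exact Subtype.ext ((hJ Λ₁ hΛ₁).2 hΛ₀V Λ₁.2 (le_antisymm (hJ Λ₁ hΛ₁).1 (h _ hmem)))
  · exact RER.J_lt_Jinf hA hW hΨc hΨp hΛ₀V hdom hmom Λ.2
      (RER.closure_LplusGamma_subset hW hΨp hΛ) fun h => hne (Subtype.ext h)
  · exact (RER.dRER_phiOpt_le hA hΨc hΨp hΨs hdom hmom hΦ').1
  · exact (RER.dRER_phiOpt_le hA hΨc hΨp hΨs hdom hmom hΦ'.1).2 (hΦ'.2 _ hfe)
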